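/- Let $k$ be a field. For $d\ge 1$, a $d$-graph $H$ is a finite vertex set $V(H)\subseteq\mathbb{Z}$ together with a set $E(H)$ of $d$-element subsets of $V(H)$, called edges. For $d\ge 2$ and $v\in V(H)$, the $v$-layer of $H$ is the $(d-1)$-graph with vertex set $\{w\in V(H) : w>v\}$ whose edges are the sets $e\subseteq\{w\in V(H): w>v\}$ with $\{v\}\cup e\in E(H)$. Every $1$-graph is cointerval; for $d\ge 2$, a $d$-graph $H$ is cointerval if every layer of $H$ is cointerval and, for all vertices $i<j$ of $H$, every edge of the $j$-layer is an edge of the $i$-layer. Let $d\ge 1$ and let $H$ be a cointerval $d$-graph with vertex set $[n]=\{1,\dots,n\}$. Let $I_H=\big\langle \prod_{v\in e}x_v : e\in E(H)\big\rangle\subseteq S=k[x_1,\dots,x_n]$ be its edge ideal, and for $i\ge 0$ and $V\subseteq[n]$ let $\beta_{i,V}(I_H)$ denote the finely graded Betti number, i.e. the number of summands $S[-V]$ in homological degree $i$ of a minimal $\mathbb{Z}^n$-graded free resolution $\cdots\to F_1\to F_0\to I_H\to 0$, where $V$ is identified with its indicator vector in $\mathbb{Z}^n$ (such a resolution exists and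 the number does not depend on it); put $\beta_{i,V}(I_H)=0$ for $i<0$. The hyper Ferrers diagram of $H$ is $$F_H=\{(v_1,\dots,v_d)\in\mathbb{N}^d : v_1<\dots<v_d,\ \{v_1,\dots,v_d\}\in E(H)\}.$$ A cube in $\mathbb{N}^d$ is a set $C=S_1\times\dots\times S_d$ with all $S_i\subseteq\mathbb{N}$ nonempty, and its coordinate set is $S_1\cup\dots\cup S_d$. Then, for every $V\subseteq[n]$, the Betti number $\beta_{|V|-d,\,V}(I_H)$ equals the number of cubes $C\subseteq F_H$ with coordinate set $V$. -/

import Mathlib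

/-- A (uniform) `d`-graph: a finite vertex set together with a set of edges, each of which is
a set of exactly `d` vertices. The vertices carry labels in a linear order `α`. -/
structure DGraph (α : Type*) [LinearOrder α] (d : ℕ) where
  verts : Finset α
  edges : Finset (Finset α)
  edges_subset : ∀ e ∈ edges, e ⊆ verts
  card_edges : ∀ e ∈ edges, e.card = d

namespace DGraph

variable {α : Type*} [LinearOrder α]

/-- The `v`-layer of a `(d+1)`-graph: the `d`-graph on the vertices after `v` whose edges are the
sets `e` of vertices after `v` such that `{v} ∪ e` is an edge. -/
def layer {d : ℕ} (H : DGraph α (d + 1)) (v : α) : DGraph α d where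
  verts := H.verts.filter (fun w => v < w)
  edges := (H.verts.filter (fun w => v < w)).powerset.filter (fun e => insert v e ∈ H.edges)
  edges_subset := by
    intro e he
    exact Finset.mem_powerset.mp (Finset.mem_filter.mp he).1
  card_edges := by
    intro e he
    obtain ⟨h1, h2⟩ := Finset.mem_filter.mp he
    have hv : v ∉ e := fun h =>
      lt_irrefl v (Finset.mem_filter.mp (Finset.mem_powerset.mp h1 h)).2
    have h3 := H.card_edges _ h2
    rw [Finset.card_insert_of_notMem hv] at h3
    omega

/-- Cointerval `d`-graphs, `d ≥ 1` (the notion is not used for `d = 0`). -/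
def IsCointerval : (d : ℕ) → DGraph α d → Prop
  | 0, _ => True
  | 1, _ => True
  | d + 2, H =>
      (∀ i ∈ H.verts, IsCointerval (d + 1) (H.layer i)) ∧
      (∀ i ∈ H.verts, ∀ j ∈ H.verts, i < j → (H.layer j).edges ⊆ (H.layer i).edges)

/-- The edge ideal of `H` in the polynomial ring `k[x_v : v a vertex of H]`, generated by the
squarefree monomials of the edges of `H`. -/
noncomputable def edgeIdeal (k : Type*) [Field k] {d : ℕ} (H : DGraph α d) :
    Ideal (MvPolynomial H.verts k) :=
  Ideal.span {f | ∃ e ∈ H.edges,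
    f = ∏ v ∈ Finset.univ.filter (fun v : H.verts => (v : α) ∈ e), MvPolynomial.X v}

/-- A set `V` of labels as a squarefree fine degree. -/
def indicator {d : ℕ} (H : DGraph α d) (V : Finset α) : H.verts → ℤ :=
  fun v => if (v : α) ∈ V then 1 else 0

/-- The hyper Ferrers diagram: all increasing `d`-tuples whose entries form an edge. -/
def hyperFerrers {d : ℕ} (H : DGraph ℕ d) : Set (Fin d → ℕ) :=
  {v | StrictMono v ∧ Finset.univ.image v ∈ H.edges}

end DGraph

/-- `C` is a cube `S 1 × ⋯ × S d` (with nonempty sides) in `ℕ^d`, and `U` is its coordinate set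
`S 1 ∪ ⋯ ∪ S d`. -/
def IsCubeWithCoordinates {d : ℕ} (C : Set (Fin d → ℕ)) (U : Set ℕ) : Prop :=
  ∃ S : Fin d → Set ℕ, (∀ i, (S i).Nonempty) ∧ C = Set.univ.pi S ∧ (⋃ i, S i) = U

/-- A minimal finely (`ℤ^σ`-) graded free resolution
`⋯ → F 2 → F 1 → F 0 → I → 0` of an ideal `I` of the polynomial ring `S = k[x_v : v ∈ σ]`.
Here `F i = S ^ (rank i)`, with its `a`-th basis vector placed in degree `deg i a`; that is,
`F i` is the direct sum of the shifted modules `S[-deg i a]`. -/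
structure MinimalGradedFreeResolution {σ k : Type*} [Field k] (I : Ideal (MvPolynomial σ k)) where
  rank : ℕ → ℕ
  deg : (i : ℕ) → Fin (rank i) → σ → ℤ
  /-- the differentials `F (i+1) → F i` -/
  d : (i : ℕ) → (Fin (rank (i + 1)) → MvPolynomial σ k) →ₗ[MvPolynomial σ k]
    (Fin (rank i) → MvPolynomial σ k)
  /-- the augmentation `F 0 → I ⊆ S` -/
  ε : (Fin (rank 0) → MvPolynomial σ k) →ₗ[MvPolynomial σ k] MvPolynomial σ k
  /-- the augmentation preserves degrees -/
  ε_homogeneous : ∀ a, ∀ m ∈ (ε (Pi.single a 1)).support, ∀ v, (m v : ℤ) = deg 0 a v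
  /-- the differentials preserve degrees -/
  d_homogeneous : ∀ i a b, ∀ m ∈ (d i (Pi.single a 1) b).support, ∀ v,
    (m v : ℤ) + deg i b v = deg (i + 1) a v
  range_ε : LinearMap.range ε = I
  exact_zero : LinearMap.range (d 0) = LinearMap.ker ε
  exact_succ : ∀ i, LinearMap.range (d (i + 1)) = LinearMap.ker (d i)
  /-- minimality: the entries of the differentials lie in the ideal generated by the variables -/
  minimal : ∀ i a b, MvPolynomial.constantCoeff (d i (Pi.single a 1) b) = 0

/-- The number of summands `S[-γ]` in homological degree `i`. For every minimal resolution of `I`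
this is the finely graded Betti number `β_{i,γ}(I)`. -/
noncomputable def MinimalGradedFreeResolution.betti {σ k : Type*} [Field k]
    {I : Ideal (MvPolynomial σ k)} (F : MinimalGradedFreeResolution I) (i : ℕ) (γ : σ → ℤ) : ℕ :=
  {a : Fin (F.rank i) | F.deg i a = γ}.ncard

/-! The cubes in the hyper Ferrers diagram are the cells of a complex of products of simplices: a
side with `m` elements is a simplex with `m` vertices. Label each cell by the product of its
coordinates. Since the tuples in the diagram are increasing, the sides of a cube are disjoint. Hence
labels are squarefree, and a cell with coordinate set `V` has dimension `|V| - d`. The points are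
the edges of `H`.

This labelled complex supports a minimal free resolution. By `range_monomialMap_eq_ker`, exactness
may be tested one multidegree `γ` at a time, where it asks that the subcomplex of cells whose label
divides `γ` be acyclic. These are the cubes with coordinates in the support of `γ`, that is, the
cubes of a restricted family of tuples, and restriction preserves the exchange property inherited
from cointervality.

Such a complex is contractible (`exists_homotopy`): if `μ` is the smallest first coordinate that
occurs, its layer contains all the others, so the first side can be coned off to `μ` without leaving
the family, and induction contracts the remaining sides inside the layer of `μ`. The resolution is
minimal because a facet loses a coordinate, so its label is strictly smaller.

Reading off the basis vectors of degree `V` counts cubes with coordinate set `V`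
(`exists_resolution`, `ncard_cubes`). The usual comparison of resolutions (`betti_eq`) transfers the
count to every minimal resolution. -/

/-! ### Homogeneous maps between finely graded free modules -/

section Homogeneous

variable {σ k : Type*} [Field k] {ι κ ρ : Type*}

/-- A vector of polynomials is homogeneous of degree `γ`, where the `b`-th basis vector has degree
`deg b`. -/
def IsHomogVec (deg : ι → σ → ℤ) (γ : σ → ℤ) (f : ι → MvPolynomial σ k) : Prop :=
  ∀ b, ∀ m ∈ (f b).support, ∀ v, (m v : ℤ) + deg b v = γ v

/-- The homogeneous component of degree `γ` of a vector of polynomials. -/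
noncomputable def homogPart (deg : ι → σ → ℤ) (γ : σ → ℤ) (f : ι → MvPolynomial σ k) :
    ι → MvPolynomial σ k := by
  classical
  exact fun b => ∑ m ∈ (f b).support.filter (fun m => ∀ v, (m v : ℤ) + deg b v = γ v),
    MvPolynomial.monomial m ((f b).coeff m)

open Classical in
theorem coeff_homogPart (deg : ι → σ → ℤ) (γ : σ → ℤ) (f : ι → MvPolynomial σ k) (b : ι)
    (m : σ →₀ ℕ) :
    (homogPart deg γ f b).coeff m =
      if ∀ v, (m v : ℤ) + deg b v = γ v then (f b).coeff m else 0 := by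
  simp only [homogPart, MvPolynomial.coeff_sum, MvPolynomial.coeff_monomial]
  rw [Finset.sum_ite_eq' ]
  simp only [Finset.mem_filter, MvPolynomial.mem_support_iff]
  split_ifs with h1 h2 h2
  · rfl
  · exact absurd h1.2 h2
  · by_contra h3
    exact h1 ⟨fun h => h3 h.symm, h2⟩
  · rfl

theorem homogPart_isHomogVec (deg : ι → σ → ℤ) (γ : σ → ℤ) (f : ι → MvPolynomial σ k) :
    IsHomogVec deg γ (homogPart deg γ f) := by
  classical
  intro b m hm
  rw [MvPolynomial.mem_support_iff, coeff_homogPart] at hm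
  by_contra h
  simp [h] at hm

theorem IsHomogVec.homogPart_eq {deg : ι → σ → ℤ} {γ : σ → ℤ} {f : ι → MvPolynomial σ k}
    (hf : IsHomogVec deg γ f) : homogPart deg γ f = f := by
  classical
  funext b
  ext m
  rw [coeff_homogPart]
  split_ifs with h
  · rfl
  · by_contra h2
    exact h (hf b m (MvPolynomial.mem_support_iff.mpr fun h3 => h2 h3.symm))

variable [Fintype ι] [DecidableEq ι] [Fintype κ] [DecidableEq κ]

/-- A linear map between graded free modules preserves degrees. -/
def IsHomogMap (dι : ι → σ → ℤ) (dκ : κ → σ → ℤ)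
    (φ : (ι → MvPolynomial σ k) →ₗ[MvPolynomial σ k] (κ → MvPolynomial σ k)) : Prop :=
  ∀ a, IsHomogVec dκ (dι a) (φ (Pi.single a 1))

theorem linearMap_apply_eq_sum {R : Type*} [CommSemiring R] (φ : (ι → R) →ₗ[R] (ρ → R))
    (f : ι → R) (b : ρ) : φ f b = ∑ a, f a * φ (Pi.single a 1) b := by
  conv_lhs => rw [pi_eq_sum_univ' f]
  simp [map_sum, Finset.sum_apply]

-- A homogeneous matrix entry shifts all degrees by the same amount, so the part of the product in
-- degree `γ` comes exactly from the part of `f` in degree `γ`.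
omit [Fintype κ] [DecidableEq κ] in
theorem IsHomogMap.homogPart_comm {dι : ι → σ → ℤ} {dκ : κ → σ → ℤ}
    {φ : (ι → MvPolynomial σ k) →ₗ[MvPolynomial σ k] (κ → MvPolynomial σ k)}
    (hφ : IsHomogMap dι dκ φ) (γ : σ → ℤ) (f : ι → MvPolynomial σ k) :
    φ (homogPart dι γ f) = homogPart dκ γ (φ f) := by
  classical
  funext b
  ext m
  rw [coeff_homogPart, linearMap_apply_eq_sum, linearMap_apply_eq_sum φ f b,
    MvPolynomial.coeff_sum, MvPolynomial.coeff_sum]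
  have key : ∀ a, (homogPart dι γ f a * φ (Pi.single a 1) b).coeff m =
      if ∀ v, (m v : ℤ) + dκ b v = γ v then (f a * φ (Pi.single a 1) b).coeff m else 0 := by
    intro a
    have : ∀ p ∈ Finset.HasAntidiagonal.antidiagonal m,
        (homogPart dι γ f a).coeff p.1 * (φ (Pi.single a 1) b).coeff p.2 =
        if ∀ v, (m v : ℤ) + dκ b v = γ v then
          (f a).coeff p.1 * (φ (Pi.single a 1) b).coeff p.2 else 0 := by
      intro p hp
      rw [coeff_homogPart]
      by_cases h0 : (φ (Pi.single a 1) b).coeff p.2 = 0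
      · simp [h0]
      · have h1 := hφ a b p.2 (MvPolynomial.mem_support_iff.mpr h0)
        have h2 : p.1 + p.2 = m := by simpa using hp
        have h3 : (∀ v, (p.1 v : ℤ) + dι a v = γ v) ↔ (∀ v, (m v : ℤ) + dκ b v = γ v) := by
          refine forall_congr' fun v => ?_
          rw [← h2, ← h1 v]
          push_cast [Finsupp.add_apply]
          constructor <;> intro h <;> linarith
        simp only [h3, ite_mul, zero_mul]
    rw [MvPolynomial.coeff_mul, MvPolynomial.coeff_mul, Finset.sum_congr rfl this]
    split_ifs <;> simp
  rw [Finset.sum_congr rfl fun a _ => key a]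
  split_ifs <;> simp

omit [Fintype κ] [DecidableEq κ] in
theorem IsHomogMap.map_isHomogVec {dι : ι → σ → ℤ} {dκ : κ → σ → ℤ}
    {φ : (ι → MvPolynomial σ k) →ₗ[MvPolynomial σ k] (κ → MvPolynomial σ k)}
    (hφ : IsHomogMap dι dκ φ) {γ : σ → ℤ} {f : ι → MvPolynomial σ k} (hf : IsHomogVec dι γ f) :
    IsHomogVec dκ γ (φ f) := by
  rw [← hf.homogPart_eq, hφ.homogPart_comm]
  exact homogPart_isHomogVec _ _ _

-- Freeness of the source. The predicate `P` records degrees for homogeneous lifts and is trivial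
-- for ungraded homotopies.
omit [Fintype κ] [DecidableEq κ] in
theorem exists_linearMap_lift {R : Type*} [CommSemiring R] (f : (ι → R) →ₗ[R] (ρ → R))
    (d : (κ → R) →ₗ[R] (ρ → R)) (P : ι → (κ → R) → Prop)
    (h : ∀ a, ∃ x, P a x ∧ d x = f (Pi.single a 1)) :
    ∃ φ : (ι → R) →ₗ[R] (κ → R), (∀ a, P a (φ (Pi.single a 1))) ∧ ∀ x, d (φ x) = f x := by
  choose g hg hd using h
  have hs : ∀ a, (Pi.basisFun R ι).constr R g (Pi.single a 1) = g a := by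
    intro a
    rw [← Pi.basisFun_apply, Module.Basis.constr_basis]
  refine ⟨(Pi.basisFun R ι).constr R g, fun a => (hs a).symm ▸ hg a, fun x => ?_⟩
  have : d ∘ₗ (Pi.basisFun R ι).constr R g = f := by
    refine (Pi.basisFun R ι).ext fun a => ?_
    simp [hs, hd]
  exact LinearMap.congr_fun this x

theorem exists_homogMap_lift {dι : ι → σ → ℤ} {dκ : κ → σ → ℤ} {dρ : ρ → σ → ℤ}
    [Fintype ρ] [DecidableEq ρ]
    {f : (ι → MvPolynomial σ k) →ₗ[MvPolynomial σ k] (ρ → MvPolynomial σ k)}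
    {d : (κ → MvPolynomial σ k) →ₗ[MvPolynomial σ k] (ρ → MvPolynomial σ k)}
    (hf : IsHomogMap dι dρ f) (hd : IsHomogMap dκ dρ d) (h : ∀ x, f x ∈ LinearMap.range d) :
    ∃ φ : (ι → MvPolynomial σ k) →ₗ[MvPolynomial σ k] (κ → MvPolynomial σ k),
      IsHomogMap dι dκ φ ∧ ∀ x, d (φ x) = f x := by
  refine exists_linearMap_lift f d (fun a x => IsHomogVec dκ (dι a) x) fun a => ?_
  obtain ⟨x, hx⟩ := h (Pi.single a 1)
  -- An arbitrary preimage need not be homogeneous, but its component in degree `dι a` is, and `d`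
  -- commutes with taking components.
  refine ⟨homogPart dκ (dι a) x, homogPart_isHomogVec _ _ _, ?_⟩
  rw [hd.homogPart_comm, hx, (hf a).homogPart_eq]

omit [Fintype κ] [DecidableEq κ] in
theorem constantCoeff_map_eq_zero
    (φ : (ι → MvPolynomial σ k) →ₗ[MvPolynomial σ k] (κ → MvPolynomial σ k))
    {f : ι → MvPolynomial σ k} (hf : ∀ a, MvPolynomial.constantCoeff (f a) = 0) (b : κ) :
    MvPolynomial.constantCoeff (φ f b) = 0 := by
  rw [linearMap_apply_eq_sum]
  simp [map_sum, hf]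

/-- Homogeneous maps that are inverse on one side modulo the variables bound the number of basis
vectors of each degree. -/
theorem ncard_deg_le_of_constantCoeff {dι : ι → σ → ℤ} {dκ : κ → σ → ℤ}
    {φ : (ι → MvPolynomial σ k) →ₗ[MvPolynomial σ k] (κ → MvPolynomial σ k)}
    {ψ : (κ → MvPolynomial σ k) →ₗ[MvPolynomial σ k] (ι → MvPolynomial σ k)}
    (hφ : IsHomogMap dι dκ φ)
    (h : ∀ a b, MvPolynomial.constantCoeff (ψ (φ (Pi.single a 1)) b) =
      (Pi.single a 1 : ι → k) b) (γ : σ → ℤ) :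
    {a | dι a = γ}.ncard ≤ {b | dκ b = γ}.ncard := by
  classical
  let P : {b // dκ b = γ} → {a // dι a = γ} → k := fun b a =>
    MvPolynomial.constantCoeff (φ (Pi.single a.1 1) b.1)
  let Q : {a // dι a = γ} → {b // dκ b = γ} → k := fun a b =>
    MvPolynomial.constantCoeff (ψ (Pi.single b.1 1) a.1)
  -- A homogeneous entry between basis vectors of different degrees has no constant term. So modulo
  -- the variables the maps split into blocks by degree, and `P`, `Q` are the blocks of degree `γ`.
  have hQP : Matrix.of Q * Matrix.of P = 1 := by
    ext c a
    have h1 := h a.1 c.1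
    rw [linearMap_apply_eq_sum ψ, map_sum] at h1
    have h2 : ∀ b, dκ b ≠ γ →
        MvPolynomial.constantCoeff (φ (Pi.single a.1 1) b * ψ (Pi.single b 1) c.1) = 0 := by
      intro b hb
      rw [map_mul]
      refine mul_eq_zero_of_left ?_ _
      by_contra h3
      refine hb ?_
      rw [← a.2]
      funext v
      have := hφ a.1 b 0 (MvPolynomial.mem_support_iff.mpr h3) v
      simpa using this
    have h3 : ∑ b : {b // dκ b = γ}, MvPolynomial.constantCoeff
        (φ (Pi.single a.1 1) b.1 * ψ (Pi.single b.1 1) c.1) = (Pi.single a.1 1 : ι → k) c.1 := by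
      rw [← h1, ← Finset.sum_subtype (p := fun b => dκ b = γ) {b | dκ b = γ} (by simp)
        (fun b => MvPolynomial.constantCoeff (φ (Pi.single a.1 1) b * ψ (Pi.single b 1) c.1)),
        Finset.sum_filter]
      refine Finset.sum_congr rfl fun b _ => ?_
      split_ifs with hb
      · rfl
      · exact (h2 b hb).symm
    rw [Matrix.mul_apply]
    simp only [P, Q, Matrix.of_apply, Matrix.one_apply]
    rw [show (if c = a then (1 : k) else 0) = (Pi.single a.1 1 : ι → k) c.1 by
      simp [Pi.single_apply, Subtype.ext_iff], ← h3]
    exact Finset.sum_congr rfl fun b _ => by rw [map_mul, mul_comm]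
  have hinj : Function.Injective (Matrix.of P).mulVecLin := by
    intro x y hxy
    have := congrArg (Matrix.of Q).mulVec hxy
    simpa [Matrix.mulVec_mulVec, hQP] using this
  have := LinearMap.finrank_le_finrank_of_injective hinj
  simp only [Module.finrank_fintype_fun_eq_card] at this
  rw [← Nat.card_coe_set_eq, ← Nat.card_coe_set_eq]
  change Nat.card {a // dι a = γ} ≤ Nat.card {b // dκ b = γ}
  rwa [Nat.card_eq_fintype_card, Nat.card_eq_fintype_card]

end Homogeneous

/-! ### Betti numbers do not depend on the minimal resolution -/

/-- Dependent choice for chain maps and homotopies: the type `T i` can carry the invariant that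
makes the next step possible. -/
theorem exists_dependent_seq {T : ℕ → Type*} (R : ∀ i, T i → T (i + 1) → Prop) (t : T 0)
    (step : ∀ i (x : T i), ∃ y, R i x y) :
    ∃ f : ∀ i, T i, f 0 = t ∧ ∀ i, R i (f i) (f (i + 1)) := by
  choose g hg using step
  exact ⟨fun i => Nat.rec t (fun i x => g i x) i, rfl, fun i => hg i _⟩

namespace MinimalGradedFreeResolution

variable {σ k : Type*} [Field k] {I : Ideal (MvPolynomial σ k)}

theorem d_isHomogMap (F : MinimalGradedFreeResolution I) (i : ℕ) :
    IsHomogMap (F.deg (i + 1)) (F.deg i) (F.d i) :=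
  fun a b m hm v => F.d_homogeneous i a b m hm v

/-- The augmentation, as a map to vectors of length one. -/
noncomputable def augVec (F : MinimalGradedFreeResolution I) :
    (Fin (F.rank 0) → MvPolynomial σ k) →ₗ[MvPolynomial σ k] (Fin 1 → MvPolynomial σ k) :=
  LinearMap.pi fun _ => F.ε

theorem augVec_isHomogMap (F : MinimalGradedFreeResolution I) :
    IsHomogMap (F.deg 0) (fun _ _ => 0) F.augVec := by
  intro a b m hm v
  simpa using F.ε_homogeneous a m hm v

theorem d_d (F : MinimalGradedFreeResolution I) (i : ℕ) (x) : F.d i (F.d (i + 1) x) = 0 := by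
  have : F.d (i + 1) x ∈ LinearMap.ker (F.d i) := F.exact_succ i ▸ LinearMap.mem_range_self _ x
  exact this

theorem ε_d (F : MinimalGradedFreeResolution I) (x) : F.ε (F.d 0 x) = 0 := by
  have : F.d 0 x ∈ LinearMap.ker F.ε := F.exact_zero ▸ LinearMap.mem_range_self _ x
  exact this

theorem constantCoeff_d (F : MinimalGradedFreeResolution I) (i : ℕ) (x) (b) :
    MvPolynomial.constantCoeff (F.d i x b) = 0 := by
  rw [linearMap_apply_eq_sum]
  simp [map_sum, F.minimal]

/-- The identity of `I` lifts to a degree-preserving map of resolutions. -/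
theorem exists_chainMap (F G : MinimalGradedFreeResolution I) :
    ∃ φ : ∀ i, (Fin (F.rank i) → MvPolynomial σ k) →ₗ[MvPolynomial σ k]
        (Fin (G.rank i) → MvPolynomial σ k),
      (∀ i, IsHomogMap (F.deg i) (G.deg i) (φ i)) ∧ (∀ x, G.ε (φ 0 x) = F.ε x) ∧
      ∀ i x, G.d i (φ (i + 1) x) = φ i (F.d i x) := by
  obtain ⟨φ₀, h₀, h₀'⟩ := exists_homogMap_lift F.augVec_isHomogMap G.augVec_isHomogMap (by
    intro x
    have : F.ε x ∈ LinearMap.range G.ε :=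
      (F.range_ε.trans G.range_ε.symm) ▸ LinearMap.mem_range_self F.ε x
    obtain ⟨y, hy⟩ := this
    exact ⟨y, by funext; simpa [augVec] using hy⟩)
  have hε : ∀ x, G.ε (φ₀ x) = F.ε x := fun x => by
    simpa [augVec] using congrFun (h₀' x) 0
  -- The range condition is exactly what the next lift requires, so it is part of the recursion
  -- data.
  let T : ℕ → Type _ := fun i => {φ : (Fin (F.rank i) → MvPolynomial σ k) →ₗ[MvPolynomial σ k]
        (Fin (G.rank i) → MvPolynomial σ k) //
        IsHomogMap (F.deg i) (G.deg i) φ ∧ ∀ x, φ (F.d i x) ∈ LinearMap.range (G.d i)}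
  obtain ⟨f, hf0, hf⟩ := exists_dependent_seq (T := T)
    (fun i φ φ' => ∀ x, G.d i (φ'.1 x) = φ.1 (F.d i x))
    ⟨φ₀, h₀, fun x => by rw [G.exact_zero, LinearMap.mem_ker, hε, F.ε_d]⟩ (by
      rintro i ⟨φ, hφ, hr⟩
      obtain ⟨φ', h1, h2⟩ := exists_homogMap_lift (f := φ ∘ₗ F.d i)
        (fun a => hφ.map_isHomogVec (F.d_isHomogMap i a)) (G.d_isHomogMap i) hr
      refine ⟨⟨φ', h1, fun x => ?_⟩, h2⟩
      rw [G.exact_succ, LinearMap.mem_ker, h2]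
      simp [F.d_d])
  refine ⟨fun i => (f i).1, fun i => (f i).2.1, fun x => ?_, hf⟩
  simp only [hf0]
  exact hε x

/-- An endomorphism of a minimal resolution over the zero map vanishes modulo the variables. -/
theorem constantCoeff_chainMap_eq_zero (F : MinimalGradedFreeResolution I)
    (δ : ∀ i, (Fin (F.rank i) → MvPolynomial σ k) →ₗ[MvPolynomial σ k]
      (Fin (F.rank i) → MvPolynomial σ k))
    (hε : ∀ x, F.ε (δ 0 x) = 0) (hδ : ∀ i x, F.d i (δ (i + 1) x) = δ i (F.d i x))
    (i : ℕ) (x) (b) : MvPolynomial.constantCoeff (δ i x b) = 0 := by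
  -- A null-homotopy `δ = d h + h d` is built; by minimality both terms have entries without
  -- constant term.
  obtain ⟨h₀, -, h₀'⟩ := exists_linearMap_lift (δ 0) (F.d 0) (fun _ _ => True) (fun a => by
    have : δ 0 (Pi.single a 1) ∈ LinearMap.range (F.d 0) := by
      rw [F.exact_zero]; exact hε _
    obtain ⟨y, hy⟩ := this
    exact ⟨y, trivial, hy⟩)
  let T : ℕ → Type _ := fun i => {h : (Fin (F.rank i) → MvPolynomial σ k) →ₗ[MvPolynomial σ k]
        (Fin (F.rank (i + 1)) → MvPolynomial σ k) //
        ∀ x, F.d i (h (F.d i x)) = δ i (F.d i x)}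
  obtain ⟨f, hf0, hf⟩ := exists_dependent_seq (T := T)
    (fun i h h' => ∀ x, F.d (i + 1) (h'.1 x) + h.1 (F.d i x) = δ (i + 1) x)
    ⟨h₀, fun x => h₀' _⟩ (by
      rintro i ⟨h, hh⟩
      obtain ⟨h', -, h2⟩ := exists_linearMap_lift (δ (i + 1) - h ∘ₗ F.d i) (F.d (i + 1))
        (fun _ _ => True) (fun a => by
          have : (δ (i + 1) - h ∘ₗ F.d i) (Pi.single a 1) ∈ LinearMap.range (F.d (i + 1)) := by
            rw [F.exact_succ, LinearMap.mem_ker]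
            simp [hδ, hh]
          obtain ⟨y, hy⟩ := this
          exact ⟨y, trivial, hy⟩)
      have h3 : ∀ x, F.d (i + 1) (h' x) + h (F.d i x) = δ (i + 1) x := fun x => by simp [h2]
      refine ⟨⟨h', fun x => ?_⟩, h3⟩
      have := h3 (F.d (i + 1) x)
      rwa [F.d_d, map_zero, add_zero] at this)
  cases i with
  | zero => rw [← h₀']; exact F.constantCoeff_d _ _ _
  | succ i =>
    rw [← hf i x, Pi.add_apply, map_add, F.constantCoeff_d, zero_add]
    exact constantCoeff_map_eq_zero _ (fun a => F.constantCoeff_d _ _ _) _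

/-- Both `ψ ∘ φ` and the identity lift the identity of `I`, so they agree modulo the variables, and
`φ` is injective there in each degree. -/
theorem betti_le (F G : MinimalGradedFreeResolution I) (i : ℕ) (γ : σ → ℤ) :
    F.betti i γ ≤ G.betti i γ := by
  obtain ⟨φ, hφ, hφε, hφd⟩ := exists_chainMap F G
  obtain ⟨ψ, -, hψε, hψd⟩ := exists_chainMap G F
  refine ncard_deg_le_of_constantCoeff (ψ := ψ i) (hφ i) (fun a b => ?_) γ
  have := F.constantCoeff_chainMap_eq_zero (fun i => ψ i ∘ₗ φ i - LinearMap.id)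
    (fun x => by simp [hψε, hφε]) (fun i x => by simp [hψd, hφd]) i (Pi.single a 1) b
  simp only [LinearMap.sub_apply, LinearMap.comp_apply, LinearMap.id_apply, Pi.sub_apply,
    map_sub, sub_eq_zero] at this
  rw [this]
  by_cases h : b = a
  · subst h; simp
  · simp [h]

theorem betti_eq (F G : MinimalGradedFreeResolution I) (i : ℕ) (γ : σ → ℤ) :
    F.betti i γ = G.betti i γ :=
  le_antisymm (betti_le F G i γ) (betti_le G F i γ)

end MinimalGradedFreeResolution

/-! ### The chain complex of cubes

A cube is a list of blocks, each a sorted list; a set of tuples is a set of lists. -/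

namespace CubeComplex

open Finsupp

variable (k : Type*) [Field k]

/-- The reduced simplicial boundary of a simplex, given by its list of vertices. -/
noncomputable def redBoundary : List ℕ → (List ℕ →₀ k)
  | [] => 0
  | a :: s => single s 1 - lmapDomain k k (a :: ·) (redBoundary s)

/-- The linear extension of the reduced simplicial boundary. -/
noncomputable def redBoundaryLin : (List ℕ →₀ k) →ₗ[k] (List ℕ →₀ k) :=
  linearCombination k (redBoundary k)

/-- The projection killing the empty simplex. -/
noncomputable def dropEmpty : (List ℕ →₀ k) →ₗ[k] (List ℕ →₀ k) :=
  linearCombination k fun s => if s = [] then 0 else single s 1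

/-- The unreduced simplicial boundary. -/
noncomputable def blockBoundary : (List ℕ →₀ k) →ₗ[k] (List ℕ →₀ k) :=
  dropEmpty k ∘ₗ redBoundaryLin k

@[simp] theorem redBoundaryLin_single (s : List ℕ) :
    redBoundaryLin k (single s 1) = redBoundary k s := by
  simp [redBoundaryLin]

@[simp] theorem dropEmpty_single (s : List ℕ) :
    dropEmpty k (single s 1) = if s = [] then 0 else single s 1 := by
  simp [dropEmpty]

theorem redBoundaryLin_cons (a : ℕ) (y : List ℕ →₀ k) :
    redBoundaryLin k (lmapDomain k k (a :: ·) y) =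
      y - lmapDomain k k (a :: ·) (redBoundaryLin k y) := by
  induction y using Finsupp.induction_linear with
  | zero => simp
  | add f g hf hg => rw [map_add, map_add, hf, hg, map_add, map_add]; abel
  | single s c =>
    rw [← mul_one c, ← smul_eq_mul, ← smul_single]
    simp only [map_smul, ← smul_sub]
    congr 1
    simp [redBoundary]

/-- From `∂(a·s) = s - a·∂s`, a second application gives `∂s - (∂s - a·∂∂s)`, which vanishes by
induction. -/
theorem redBoundaryLin_redBoundary (s : List ℕ) : redBoundaryLin k (redBoundary k s) = 0 := by
  induction s with
  | nil => simp [redBoundary]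
  | cons a s ih =>
    rw [redBoundary, map_sub, redBoundaryLin_cons, ih]
    simp

/-- The empty simplex has zero boundary, so discarding it between two boundaries changes nothing. -/
theorem redBoundaryLin_dropEmpty (y : List ℕ →₀ k) :
    redBoundaryLin k (dropEmpty k y) = redBoundaryLin k y := by
  induction y using Finsupp.induction_linear with
  | zero => simp
  | add f g hf hg => rw [map_add, map_add, hf, hg, map_add]
  | single s c =>
    rw [← mul_one c, ← smul_eq_mul, ← smul_single]
    simp only [map_smul]
    congr 1
    cases s <;> simp [redBoundary]

theorem blockBoundary_blockBoundary (y : List ℕ →₀ k) :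
    blockBoundary k (blockBoundary k y) = 0 := by
  simp only [blockBoundary, LinearMap.comp_apply, redBoundaryLin_dropEmpty]
  suffices redBoundaryLin k (redBoundaryLin k y) = 0 by rw [this, map_zero]
  induction y using Finsupp.induction_linear with
  | zero => simp
  | add f g hf hg => rw [map_add, map_add, hf, hg, add_zero]
  | single s c =>
    rw [← mul_one c, ← smul_eq_mul, ← smul_single]
    simp only [map_smul, redBoundaryLin_single, redBoundaryLin_redBoundary, smul_zero]

/-- The grading sign `(-1) ^ (|s| - 1)`. -/
noncomputable def gradeSign : (List ℕ →₀ k) →ₗ[k] (List ℕ →₀ k) :=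
  linearCombination k fun s => single s ((-1) ^ (s.length + 1))

theorem gradeSign_single (s : List ℕ) :
    gradeSign k (single s 1) = ((-1) ^ (s.length + 1) : k) • single s 1 := by
  simp [gradeSign]

theorem redBoundary_length (s : List ℕ) :
    redBoundary k s ∈ supported k k {t | t.length + 1 = s.length ∧ t.Sublist s} := by
  induction s with
  | nil => simp [redBoundary]
  | cons a s ih =>
    rw [redBoundary]
    refine Submodule.sub_mem _ (single_mem_supported k 1 (by simp)) ?_
    have : lmapDomain k k (a :: ·) (redBoundary k s) ∈
        (supported k k {t | t.length + 1 = s.length ∧ t.Sublist s}).map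
          (lmapDomain k k (a :: ·)) := ⟨_, ih, rfl⟩
    rw [lmapDomain_supported] at this
    refine supported_mono ?_ this
    rintro _ ⟨t, ⟨h1, h2⟩, rfl⟩
    exact ⟨by simp [h1], h2.cons_cons a⟩

theorem blockBoundary_mem (s : List ℕ) :
    blockBoundary k (single s 1) ∈
      supported k k {t | t.length + 1 = s.length ∧ t.Sublist s ∧ t ≠ []} := by
  rw [blockBoundary, LinearMap.comp_apply, redBoundaryLin_single]
  have h := redBoundary_length k s
  rw [supported_eq_span_single] at h
  refine Submodule.span_induction ?_ (by simp) (fun x y _ _ hx hy => ?_) (fun c x _ hx => ?_) h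
  · rintro _ ⟨t, ⟨h1, h2⟩, rfl⟩
    rw [dropEmpty_single]
    split_ifs with ht
    · exact Submodule.zero_mem _
    · exact single_mem_supported k 1 ⟨h1, h2, ht⟩
  · rw [map_add]; exact Submodule.add_mem _ hx hy
  · rw [map_smul]; exact Submodule.smul_mem _ c hx

theorem gradeSign_of_length {n : ℕ} {y : List ℕ →₀ k}
    (hy : y ∈ supported k k {t | t.length = n}) : gradeSign k y = ((-1) ^ (n + 1) : k) • y := by
  rw [supported_eq_span_single] at hy
  refine Submodule.span_induction ?_ (by simp) (fun x y _ _ hx hy => ?_) (fun c x _ hx => ?_) hy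
  · rintro _ ⟨t, rfl, rfl⟩
    rw [gradeSign_single]
  · rw [map_add, hx, hy, smul_add]
  · rw [map_smul, hx, smul_comm]

/-- The boundary shortens a block by one, which flips the sign. -/
theorem blockBoundary_gradeSign (y : List ℕ →₀ k) :
    blockBoundary k (gradeSign k y) = - gradeSign k (blockBoundary k y) := by
  induction y using Finsupp.induction_linear with
  | zero => simp
  | add f g hf hg => simp only [map_add, hf, hg, neg_add]
  | single s c =>
    rw [← mul_one c, ← smul_eq_mul, ← smul_single]
    simp only [map_smul, ← smul_neg]
    congr 1
    rw [gradeSign_single, map_smul]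
    cases s with
    | nil => simp [blockBoundary, redBoundary]
    | cons a s =>
      rw [gradeSign_of_length k (n := s.length)
        (supported_mono (fun t ht => by simpa using ht.1) (blockBoundary_mem k (a :: s)))]
      simp [pow_succ]

theorem gradeSign_gradeSign (y : List ℕ →₀ k) : gradeSign k (gradeSign k y) = y := by
  induction y using Finsupp.induction_linear with
  | zero => simp
  | add f g hf hg => simp only [map_add, hf, hg]
  | single s c =>
    rw [← mul_one c, ← smul_eq_mul, ← smul_single]
    simp only [map_smul]
    congr 1
    rw [gradeSign_single, map_smul, gradeSign_single, smul_smul, ← pow_add, Even.neg_one_pow,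
      one_smul]
    exact ⟨_, rfl⟩

/-! ### Products of blocks: boundary and augmentation of cubes -/

/-- Prepending a chain of blocks to a chain of cubes. -/
noncomputable def prod : (List ℕ →₀ k) →ₗ[k] (List (List ℕ) →₀ k) →ₗ[k] (List (List ℕ) →₀ k) :=
  linearCombination k fun s => lmapDomain k k (s :: ·)

@[simp] theorem prod_single (s : List ℕ) (L : List (List ℕ)) :
    prod k (single s 1) (single L 1) = single (s :: L) 1 := by
  simp [prod]

/-- The boundary of a cube. -/
noncomputable def boundary : List (List ℕ) → (List (List ℕ) →₀ k)
  | [] => 0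
  | s :: L => prod k (blockBoundary k (single s 1)) (single L 1) +
      prod k (gradeSign k (single s 1)) (boundary L)

/-- The linear extension of the boundary of cubes. -/
noncomputable def boundaryLin : (List (List ℕ) →₀ k) →ₗ[k] (List (List ℕ) →₀ k) :=
  linearCombination k (boundary k)

@[simp] theorem boundaryLin_single (L : List (List ℕ)) :
    boundaryLin k (single L 1) = boundary k L := by
  simp [boundaryLin]

/-- Two bilinear expressions agree if they agree on basis vectors. -/
theorem bilin_ext {α β M : Type*} [AddCommGroup M] [Module k M]
    {f g : (α →₀ k) →ₗ[k] (β →₀ k) →ₗ[k] M}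
    (h : ∀ a b, f (single a 1) (single b 1) = g (single a 1) (single b 1)) : f = g := by
  ext a b
  simpa using h a b

/-- The graded Leibniz rule, which on basis vectors is the definition of `boundary`. -/
theorem boundaryLin_prod (y : List ℕ →₀ k) (x : List (List ℕ) →₀ k) :
    boundaryLin k (prod k y x) =
      prod k (blockBoundary k y) x + prod k (gradeSign k y) (boundaryLin k x) := by
  have : (prod k).compr₂ (boundaryLin k) =
      (prod k ∘ₗ blockBoundary k) + (prod k ∘ₗ gradeSign k).compl₂ (boundaryLin k) := by
    refine bilin_ext k fun s L => ?_
    simp [boundary]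
  exact LinearMap.congr_fun (LinearMap.congr_fun this y) x

/-- By the Leibniz rule the two mixed terms cancel, because `gradeSign` anticommutes with the block
boundary. -/
theorem boundaryLin_boundary (L : List (List ℕ)) : boundaryLin k (boundary k L) = 0 := by
  induction L with
  | nil => simp [boundary]
  | cons s L ih =>
    simp [boundary, map_add, boundaryLin_prod, ih, blockBoundary_blockBoundary,
      blockBoundary_gradeSign, gradeSign_gradeSign]

/-- The augmentation of a block. -/
noncomputable def blockAug : (List ℕ →₀ k) →ₗ[k] k :=
  linearCombination k fun s => if s.length = 1 then 1 else 0

/-- The augmentation: points have value one. -/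
noncomputable def aug : (List (List ℕ) →₀ k) →ₗ[k] k :=
  linearCombination k fun L => if ∀ s ∈ L, s.length = 1 then 1 else 0

theorem aug_single (L : List (List ℕ)) :
    aug k (single L 1) = if ∀ s ∈ L, s.length = 1 then 1 else 0 := by
  simp [aug]

theorem blockAug_single (s : List ℕ) :
    blockAug k (single s 1) = if s.length = 1 then 1 else 0 := by
  simp [blockAug]

theorem aug_prod (y : List ℕ →₀ k) (x : List (List ℕ) →₀ k) :
    aug k (prod k y x) = blockAug k y * aug k x := by
  have : (prod k).compr₂ (aug k) = (LinearMap.mul k k).compl₁₂ (blockAug k) (aug k) := by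
    refine bilin_ext k fun s L => ?_
    simp only [LinearMap.compr₂_apply, prod_single, LinearMap.compl₁₂_apply, LinearMap.mul_apply',
      aug_single, blockAug_single, List.forall_mem_cons]
    split_ifs <;> simp_all
  exact LinearMap.congr_fun (LinearMap.congr_fun this y) x

/-- Only a block with two entries has single vertices in its boundary, and these come with opposite
signs. -/
theorem blockAug_blockBoundary (y : List ℕ →₀ k) : blockAug k (blockBoundary k y) = 0 := by
  have : blockAug k ∘ₗ blockBoundary k = 0 := by
    ext s
    simp only [LinearMap.comp_apply, lsingle_apply, LinearMap.zero_apply]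
    rcases s with _ | ⟨a, _ | ⟨b, _ | ⟨c, s⟩⟩⟩
    · simp [blockBoundary, redBoundary]
    · simp [blockBoundary, redBoundary]
    · simp [blockBoundary, redBoundary, blockAug_single]
    · have h := blockBoundary_mem k (a :: b :: c :: s)
      rw [supported_eq_span_single] at h
      refine Submodule.span_induction ?_ (by simp) (fun x y _ _ hx hy => ?_)
        (fun c x _ hx => ?_) h
      · rintro _ ⟨t, ⟨h1, h2⟩, rfl⟩
        rw [blockAug_single, if_neg]
        simp at h1; omega
      · rw [map_add, hx, hy, add_zero]
      · rw [map_smul, hx, smul_zero]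
  exact LinearMap.congr_fun this y

theorem blockAug_gradeSign (y : List ℕ →₀ k) : blockAug k (gradeSign k y) = blockAug k y := by
  have : blockAug k ∘ₗ gradeSign k = blockAug k := by
    ext s
    simp only [LinearMap.comp_apply, lsingle_apply, gradeSign_single, map_smul, blockAug_single]
    split_ifs with h <;> simp [h]
  exact LinearMap.congr_fun this y

theorem aug_boundary (L : List (List ℕ)) : aug k (boundary k L) = 0 := by
  induction L with
  | nil => simp [boundary]
  | cons s L ih => simp [boundary, aug_prod, blockAug_blockBoundary, ih]

/-! ### The contracting homotopy -/

/-- The cone operator with apex `μ` on blocks. -/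
noncomputable def blockCone (μ : ℕ) : (List ℕ →₀ k) →ₗ[k] (List ℕ →₀ k) :=
  linearCombination k fun s => if s = [] ∨ s.head? = some μ then 0 else single (μ :: s) 1

theorem blockCone_single (μ : ℕ) (s : List ℕ) :
    blockCone k μ (single s 1) =
      if s = [] ∨ s.head? = some μ then 0 else single (μ :: s) 1 := by
  simp [blockCone]

theorem blockCone_cons_self (μ : ℕ) (y : List ℕ →₀ k) :
    blockCone k μ (lmapDomain k k (μ :: ·) y) = 0 := by
  have : blockCone k μ ∘ₗ lmapDomain k k (μ :: ·) = 0 := by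
    ext s : 2
    simp [blockCone_single]
  exact LinearMap.congr_fun this y

theorem blockCone_cons {μ a : ℕ} (h : a ≠ μ) (y : List ℕ →₀ k) :
    blockCone k μ (lmapDomain k k (a :: ·) y) =
      lmapDomain k k (μ :: ·) (lmapDomain k k (a :: ·) y) := by
  have : blockCone k μ ∘ₗ lmapDomain k k (a :: ·) =
      lmapDomain k k (μ :: ·) ∘ₗ lmapDomain k k (a :: ·) := by
    ext s : 2
    simp [blockCone_single, h]
  exact LinearMap.congr_fun this y

theorem dropEmpty_cons (a : ℕ) (y : List ℕ →₀ k) :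
    dropEmpty k (lmapDomain k k (a :: ·) y) = lmapDomain k k (a :: ·) y := by
  have : dropEmpty k ∘ₗ lmapDomain k k (a :: ·) = lmapDomain k k (a :: ·) := by
    ext s : 2
    simp
  exact LinearMap.congr_fun this y

theorem blockBoundary_cons_cons (a b : ℕ) (t : List ℕ) :
    blockBoundary k (single (a :: b :: t) 1) =
      single (b :: t) 1 - lmapDomain k k (a :: ·) (redBoundary k (b :: t)) := by
  simp only [blockBoundary, LinearMap.comp_apply, redBoundaryLin_single]
  rw [redBoundary, map_sub, dropEmpty_cons]
  simp

/-- If `s` starts with `μ`, its cone is zero, but the cone over the face without `μ` gives `s` back;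
`μ ∉ s.tail` ensures that this face is not itself killed. The correction `[μ]` comes from single
vertices. -/
theorem blockCone_homotopy {μ : ℕ} {s : List ℕ} (hs : s ≠ []) (hμ : μ ∉ s.tail) :
    blockBoundary k (blockCone k μ (single s 1)) + blockCone k μ (blockBoundary k (single s 1)) =
      single s 1 - blockAug k (single s 1) • single [μ] 1 := by
  rcases s with _ | ⟨a, _ | ⟨b, t⟩⟩
  · exact absurd rfl hs
  · have h1 : blockBoundary k (single [a] 1) = 0 := by
      simp [blockBoundary, redBoundary]
    rw [h1, map_zero, add_zero, blockCone_single, blockAug_single]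
    by_cases h : a = μ
    · simp [h]
    · simp [h, blockBoundary_cons_cons, redBoundary]
  · have hb : b ≠ μ := by rintro rfl; simp at hμ
    rw [blockCone_single, blockAug_single, blockBoundary_cons_cons, map_sub, blockCone_single]
    by_cases h : a = μ
    · subst h
      rw [blockCone_cons_self]
      simp [hb]
    · rw [blockCone_cons k h]
      simp only [reduceCtorEq, List.head?_cons, Option.some.injEq, h, or_self, if_false,
        blockBoundary_cons_cons, hb]
      rw [redBoundary, map_sub]
      simp only [lmapDomain_apply, mapDomain_single, List.length_cons]
      simp

theorem gradeSign_blockCone (μ : ℕ) (y : List ℕ →₀ k) :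
    gradeSign k (blockCone k μ y) = - blockCone k μ (gradeSign k y) := by
  have : gradeSign k ∘ₗ blockCone k μ = - (blockCone k μ ∘ₗ gradeSign k) := by
    ext s : 2
    simp only [LinearMap.comp_apply, lsingle_apply, LinearMap.neg_apply, gradeSign_single,
      map_smul, blockCone_single]
    split_ifs with h
    · simp
    · simp [gradeSign_single, pow_succ]
  exact LinearMap.congr_fun this y

/-- The homotopy on cubes from the cone with apex `μ` on the first block and a homotopy `h` on the
remaining blocks. -/
noncomputable def coneHomotopy (μ : ℕ) (h : (List (List ℕ) →₀ k) →ₗ[k] (List (List ℕ) →₀ k)) :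
    (List (List ℕ) →₀ k) →ₗ[k] (List (List ℕ) →₀ k) :=
  linearCombination k fun L => match L with
    | [] => 0
    | s :: L => prod k (blockCone k μ (single s 1)) (single L 1) +
        prod k (blockAug k (single s 1) • single [μ] 1) (h (single L 1))

theorem coneHomotopy_prod (μ : ℕ) (h : (List (List ℕ) →₀ k) →ₗ[k] (List (List ℕ) →₀ k))
    (y : List ℕ →₀ k) (x : List (List ℕ) →₀ k) :
    coneHomotopy k μ h (prod k y x) =
      prod k (blockCone k μ y) x + prod k (blockAug k y • single [μ] 1) (h x) := by
  have : (prod k).compr₂ (coneHomotopy k μ h) = (prod k ∘ₗ blockCone k μ) +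
      (prod k ∘ₗ (LinearMap.toSpanSingleton k _ (single [μ] 1)) ∘ₗ blockAug k).compl₂ h := by
    refine bilin_ext k fun s L => ?_
    simp [coneHomotopy]
  exact LinearMap.congr_fun (LinearMap.congr_fun this y) x

/-- The first block is contracted to `[μ]`, then `h` contracts the rest. The identity for `h` is
needed only for a single vertex `s`, since otherwise `blockAug` kills the terms containing `h`. -/
theorem coneHomotopy_homotopy (μ : ℕ) (h : (List (List ℕ) →₀ k) →ₗ[k] (List (List ℕ) →₀ k))
    (s : List ℕ) (L B : List (List ℕ)) (hs : s ≠ []) (hμ : μ ∉ s.tail)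
    (hL : s.length = 1 → boundaryLin k (h (single L 1)) + h (boundary k L) =
      single L 1 - aug k (single L 1) • single B 1) :
    boundaryLin k (coneHomotopy k μ h (single (s :: L) 1)) +
      coneHomotopy k μ h (boundary k (s :: L)) =
        single (s :: L) 1 - aug k (single (s :: L) 1) • single ([μ] :: B) 1 := by
  have hsgn : gradeSign k (single [μ] 1) = single [μ] 1 := by simp [gradeSign_single]
  have hb : blockBoundary k (single [μ] 1) = 0 := by simp [blockBoundary, redBoundary]
  have hc := blockCone_homotopy k hs hμ
  rw [← prod_single, boundary, map_add, coneHomotopy_prod, coneHomotopy_prod, coneHomotopy_prod,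
    map_add, boundaryLin_prod, boundaryLin_prod, aug_prod, blockAug_gradeSign,
    blockAug_blockBoundary, gradeSign_blockCone, boundaryLin_single]
  simp only [map_smul, hsgn, hb, LinearMap.smul_apply, map_neg, LinearMap.neg_apply, zero_smul,
    map_zero, LinearMap.zero_apply, smul_zero, zero_add, add_zero]
  have h1 : prod k (blockBoundary k (blockCone k μ (single s 1))) (single L 1) +
      prod k (blockCone k μ (blockBoundary k (single s 1))) (single L 1) =
      prod k (single s 1) (single L 1) -
        blockAug k (single s 1) • prod k (single [μ] 1) (single L 1) := by
    rw [← LinearMap.add_apply, ← map_add, hc, map_sub, map_smul]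
    rfl
  have h2 : blockAug k (single s 1) • prod k (single [μ] 1) (boundaryLin k (h (single L 1))) +
      blockAug k (single s 1) • prod k (single [μ] 1) (h (boundary k L)) =
      blockAug k (single s 1) • prod k (single [μ] 1) (single L 1) -
        (blockAug k (single s 1) * aug k (single L 1)) • single ([μ] :: B) 1 := by
    rw [← smul_add, ← map_add, mul_smul, ← smul_sub, ← prod_single]
    by_cases h1 : s.length = 1
    · rw [hL h1, map_sub, map_smul]
    · simp [blockAug_single, h1]
  rw [← sub_eq_zero] at h1 h2 ⊢
  rw [← add_zero (0 : List (List ℕ) →₀ k)]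
  nth_rw 1 [← h1]
  rw [← h2]
  abel

end CubeComplex

/-! ### Exchange families of tuples and the cubes inside them -/

namespace CubeComplex

open Finsupp

/-- The tuples that extend the first entry `a` to a member of `F`. -/
def tupleLayer (F : Set (List ℕ)) (a : ℕ) : Set (List ℕ) := {l | a :: l ∈ F}

/-- The exchange property of the tuples of a cointerval `d`-graph. -/
def IsExchange : ℕ → Set (List ℕ) → Prop
  | 0, F => ∀ l ∈ F, l = []
  | d + 1, F => [] ∉ F ∧ (∀ a, IsExchange d (tupleLayer F a)) ∧
      ∀ a b, a < b → (tupleLayer F a).Nonempty → tupleLayer F b ⊆ tupleLayer F a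

/-- The list of blocks `L` spans a cube all of whose members lie in `F`. -/
def IsCubeIn : Set (List ℕ) → List (List ℕ) → Prop
  | F, [] => [] ∈ F
  | F, s :: L => s ≠ [] ∧ s.Pairwise (· < ·) ∧ ∀ a ∈ s, IsCubeIn (tupleLayer F a) L

theorem IsCubeIn.mono {F G : Set (List ℕ)} (h : F ⊆ G) {L : List (List ℕ)}
    (hL : IsCubeIn F L) : IsCubeIn G L := by
  induction L generalizing F G with
  | nil => exact h hL
  | cons s L ih =>
    exact ⟨hL.1, hL.2.1, fun a ha => ih (fun l hl => h hl) (hL.2.2 a ha)⟩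

theorem IsCubeIn.exists_mem {F : Set (List ℕ)} {L : List (List ℕ)} (hL : IsCubeIn F L) :
    ∃ l, l ∈ F := by
  induction L generalizing F with
  | nil => exact ⟨_, hL⟩
  | cons s L ih =>
    obtain ⟨a, ha⟩ := List.exists_mem_of_ne_nil s hL.1
    obtain ⟨l, hl⟩ := ih (hL.2.2 a ha)
    exact ⟨_, hl⟩

theorem IsCubeIn.exists_mem_of_mem_flatten {F : Set (List ℕ)} {L : List (List ℕ)}
    (hL : IsCubeIn F L) {b : ℕ} (hb : b ∈ L.flatten) : ∃ l ∈ F, b ∈ l := by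
  induction L generalizing F with
  | nil => simp at hb
  | cons s L ih =>
    rw [List.flatten_cons, List.mem_append] at hb
    rcases hb with hb | hb
    · obtain ⟨l, hl⟩ := (hL.2.2 b hb).exists_mem
      exact ⟨b :: l, hl, by simp⟩
    · obtain ⟨a, ha⟩ := List.exists_mem_of_ne_nil s hL.1
      obtain ⟨l, hl, hbl⟩ := ih (hL.2.2 a ha) hb
      exact ⟨a :: l, hl, by simp [hbl]⟩

/-- Entries of an earlier and a later block occur in this order in a common member of `F`. So blocks
are disjoint, and the flattened list enumerates the coordinate set without repetition. -/
theorem IsCubeIn.flatten_pairwise {F : Set (List ℕ)} (hF : ∀ l ∈ F, l.Pairwise (· < ·))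
    {L : List (List ℕ)} (hL : IsCubeIn F L) : L.flatten.Pairwise (· < ·) := by
  induction L generalizing F with
  | nil => simp
  | cons s L ih =>
    rw [List.flatten_cons, List.pairwise_append]
    refine ⟨hL.2.1, ?_, fun a ha b hb => ?_⟩
    · obtain ⟨a, ha⟩ := List.exists_mem_of_ne_nil s hL.1
      exact ih (fun l hl => (List.pairwise_cons.mp (hF _ hl)).2) (hL.2.2 a ha)
    · obtain ⟨l, hl, hbl⟩ := (hL.2.2 a ha).exists_mem_of_mem_flatten hb
      exact (List.pairwise_cons.mp (hF _ hl)).1 b hbl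

theorem IsCubeIn.ne_nil {F : Set (List ℕ)} {L : List (List ℕ)} (hL : IsCubeIn F L) :
    ∀ s ∈ L, s ≠ [] := by
  induction L generalizing F with
  | nil => simp
  | cons s L ih =>
    obtain ⟨a, ha⟩ := List.exists_mem_of_ne_nil s hL.1
    exact List.forall_mem_cons.mpr ⟨hL.1, ih (hL.2.2 a ha)⟩

theorem IsCubeIn.length_eq {d : ℕ} {F : Set (List ℕ)} (hF : IsExchange d F)
    {L : List (List ℕ)} (hL : IsCubeIn F L) : L.length = d := by
  induction L generalizing F d with
  | nil =>
    cases d with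
    | zero => rfl
    | succ d => exact absurd hL hF.1
  | cons s L ih =>
    obtain ⟨a, ha⟩ := List.exists_mem_of_ne_nil s hL.1
    cases d with
    | zero =>
      obtain ⟨l, hl⟩ := (hL.2.2 a ha).exists_mem
      exact absurd (hF _ hl) (by simp)
    | succ d => simp [ih (hF.2.1 a) (hL.2.2 a ha)]

theorem length_le_length_flatten {L : List (List ℕ)} (hL : ∀ s ∈ L, s ≠ []) :
    L.length ≤ L.flatten.length := by
  induction L with
  | nil => simp
  | cons s L ih =>
    rw [List.forall_mem_cons] at hL
    have h1 := ih hL.2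
    have h2 := List.length_pos_iff.mpr hL.1
    simp only [List.length_cons, List.flatten_cons, List.length_append]
    omega

theorem length_flatten_eq_iff {L : List (List ℕ)} (hL : ∀ s ∈ L, s ≠ []) :
    L.flatten.length = L.length ↔ ∀ s ∈ L, s.length = 1 := by
  induction L with
  | nil => simp
  | cons s L ih =>
    rw [List.forall_mem_cons] at hL
    have h1 := length_le_length_flatten hL.2
    have h2 := List.length_pos_iff.mpr hL.1
    rw [List.forall_mem_cons, ← ih hL.2]
    simp only [List.length_cons, List.flatten_cons, List.length_append]
    omega

/-- The tuples of `F` with all entries in `W`. -/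
def restrict (F : Set (List ℕ)) (W : Set ℕ) : Set (List ℕ) := {l | l ∈ F ∧ ∀ a ∈ l, a ∈ W}

theorem tupleLayer_restrict (F : Set (List ℕ)) {W : Set ℕ} {a : ℕ} (ha : a ∈ W) :
    tupleLayer (restrict F W) a = restrict (tupleLayer F a) W := by
  ext l
  simp [tupleLayer, restrict, ha]

theorem tupleLayer_restrict_of_notMem (F : Set (List ℕ)) {W : Set ℕ} {a : ℕ} (ha : a ∉ W) :
    tupleLayer (restrict F W) a = ∅ := by
  ext l
  simp [tupleLayer, restrict, ha]

theorem isExchange_empty (d : ℕ) : IsExchange d ∅ := by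
  induction d with
  | zero => simp [IsExchange]
  | succ d ih => exact ⟨by simp, fun a => ih, fun a b _ h => h.elim fun _ hl => hl.elim⟩

/-- Exchange alters only the first entry, and nonemptiness of the restricted layer of `a` forces `a
∈ W`. -/
theorem IsExchange.restrict {d : ℕ} {F : Set (List ℕ)} (hF : IsExchange d F) (W : Set ℕ) :
    IsExchange d (restrict F W) := by
  induction d generalizing F with
  | zero => exact fun l hl => hF l hl.1
  | succ d ih =>
    refine ⟨fun h => hF.1 h.1, fun a => ?_, ?_⟩
    · by_cases ha : a ∈ W
      · rw [tupleLayer_restrict F ha]; exact ih (hF.2.1 a)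
      · rw [tupleLayer_restrict_of_notMem F ha]; exact isExchange_empty d
    · rintro a b hab ⟨l, hl⟩ l' hl'
      refine ⟨hF.2.2 a b hab ⟨l, hl.1⟩ hl'.1, ?_⟩
      rw [List.forall_mem_cons]
      exact ⟨hl.2 a (by simp), (List.forall_mem_cons.mp hl'.2).2⟩

theorem isCubeIn_restrict_iff {F : Set (List ℕ)} {W : Set ℕ} {L : List (List ℕ)} :
    IsCubeIn (restrict F W) L ↔ IsCubeIn F L ∧ ∀ b ∈ L.flatten, b ∈ W := by
  constructor
  · refine fun h => ⟨h.mono fun l hl => hl.1, fun b hb => ?_⟩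
    obtain ⟨l, hl, hbl⟩ := h.exists_mem_of_mem_flatten hb
    exact hl.2 b hbl
  · rintro ⟨h, hW⟩
    induction L generalizing F with
    | nil => exact ⟨h, by simp⟩
    | cons s L ih =>
      simp only [List.flatten_cons, List.mem_append] at hW
      refine ⟨h.1, h.2.1, fun a ha => ?_⟩
      rw [tupleLayer_restrict F (hW a (Or.inl ha))]
      exact ih (h.2.2 a ha) fun b hb => hW b (Or.inr hb)

/-! ### Acyclicity of the complex of cubes -/

variable (k : Type*) [Field k]

theorem prod_mem_supported {A : Set (List ℕ)} {B : Set (List (List ℕ))} {y : List ℕ →₀ k}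
    {x : List (List ℕ) →₀ k} (hy : y ∈ supported k k A) (hx : x ∈ supported k k B) :
    prod k y x ∈ supported k k {L | ∃ s ∈ A, ∃ L' ∈ B, L = s :: L'} := by
  rw [supported_eq_span_single] at hy hx
  refine Submodule.span_induction ?_ (by simp) (fun u v _ _ hu hv => ?_) (fun c u _ hu => ?_) hy
  · rintro _ ⟨s, hs, rfl⟩
    refine Submodule.span_induction ?_ (by simp) (fun u v _ _ hu hv => ?_)
      (fun c u _ hu => ?_) hx
    · rintro _ ⟨L, hL, rfl⟩
      rw [prod_single]
      exact single_mem_supported k 1 ⟨s, hs, L, hL, rfl⟩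
    · rw [map_add]; exact Submodule.add_mem _ hu hv
    · rw [map_smul]; exact Submodule.smul_mem _ c hu
  · rw [map_add]; exact Submodule.add_mem _ hu hv
  · rw [map_smul]; exact Submodule.smul_mem _ c hu

/-- A facet deletes one entry from one block. The drop in length and the sublist relation are kept
because they make labels strictly smaller. -/
theorem boundary_mem {F : Set (List ℕ)} {L : List (List ℕ)} (hL : IsCubeIn F L) :
    boundary k L ∈ supported k k {L' | IsCubeIn F L' ∧
      L'.flatten.length + 1 = L.flatten.length ∧ L'.flatten.Sublist L.flatten} := by
  induction L generalizing F with
  | nil => simp [boundary]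
  | cons s L ih =>
    rw [boundary]
    refine Submodule.add_mem _ ?_ ?_
    · refine supported_mono ?_ (prod_mem_supported k (blockBoundary_mem k s)
        (single_mem_supported k (1 : k) (Set.mem_singleton L)))
      rintro _ ⟨t, ⟨h1, h2, h3⟩, _, rfl, rfl⟩
      refine ⟨⟨h3, hL.2.1.sublist h2, fun a ha => hL.2.2 a (h2.subset ha)⟩, ?_, ?_⟩
      · simp only [List.flatten_cons, List.length_append]; omega
      · simpa using h2
    -- The induction hypothesis holds in the layer of each `a ∈ s` separately, and `boundary k L`
    -- does not depend on `a`, so its cubes lie in all these layers at once.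
    · have h : boundary k L ∈ supported k k {L' | (∀ a ∈ s, IsCubeIn (tupleLayer F a) L') ∧
          L'.flatten.length + 1 = L.flatten.length ∧ L'.flatten.Sublist L.flatten} := by
        rw [mem_supported]
        intro L' hL'
        obtain ⟨a, ha⟩ := List.exists_mem_of_ne_nil s hL.1
        exact ⟨fun b hb => ((mem_supported k _).mp (ih (hL.2.2 b hb)) hL').1,
          ((mem_supported k _).mp (ih (hL.2.2 a ha)) hL').2⟩
      rw [gradeSign_single]
      refine supported_mono ?_ (prod_mem_supported k (Submodule.smul_mem _ _
        (single_mem_supported k (1 : k) (Set.mem_singleton s))) h)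
      rintro _ ⟨_, rfl, L', ⟨h1, h2, h3⟩, rfl⟩
      refine ⟨⟨hL.1, hL.2.1, h1⟩, ?_, ?_⟩
      · simp only [List.flatten_cons, List.length_append]; omega
      · simpa using h3

/-- The complex of cubes in an exchange family is contractible. -/
theorem exists_homotopy {d : ℕ} {F : Set (List ℕ)} (hF : IsExchange d F) (hne : F.Nonempty) :
    ∃ (h : (List (List ℕ) →₀ k) →ₗ[k] (List (List ℕ) →₀ k)) (B : List (List ℕ)),
      ∀ L, IsCubeIn F L →
        h (single L 1) ∈ supported k k {L' | IsCubeIn F L' ∧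
          L'.flatten.length = L.flatten.length + 1} ∧
        boundaryLin k (h (single L 1)) + h (boundary k L) =
          single L 1 - aug k (single L 1) • single B 1 := by
  induction d generalizing F with
  | zero =>
    refine ⟨0, [], fun L hL => ⟨by simp, ?_⟩⟩
    obtain rfl := List.length_eq_zero_iff.mp (hL.length_eq hF)
    simp [aug_single]
  | succ d ih =>
    have hne' : {a | (tupleLayer F a).Nonempty}.Nonempty := by
      obtain ⟨l, hl⟩ := hne
      cases l with
      | nil => exact absurd hl hF.1
      | cons a l => exact ⟨a, l, hl⟩
    -- Exchange makes the layer of the least first entry `μ` contain all others, so adjoining `μ` to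
    -- a first block stays in `F`.
    obtain ⟨μ, hμ, hmin⟩ : ∃ μ, (tupleLayer F μ).Nonempty ∧
        ∀ a, (tupleLayer F a).Nonempty → μ ≤ a :=
      ⟨sInf _, Nat.sInf_mem hne', fun a ha => Nat.sInf_le ha⟩
    have hsub : ∀ a, (tupleLayer F a).Nonempty → tupleLayer F a ⊆ tupleLayer F μ := by
      intro a ha
      rcases (hmin a ha).eq_or_lt with rfl | h
      · exact subset_rfl
      · exact hF.2.2 μ a h hμ
    obtain ⟨h, B, hB⟩ := ih (hF.2.1 μ) hμ
    refine ⟨coneHomotopy k μ h, [μ] :: B, fun L hL => ?_⟩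
    cases L with
    | nil => exact absurd hL hF.1
    | cons s L =>
      obtain ⟨hs, hsort, hcube⟩ := hL
      have hle : ∀ a ∈ s, μ ≤ a := fun a ha => hmin a (hcube a ha).exists_mem
      have hLμ : IsCubeIn (tupleLayer F μ) L := by
        obtain ⟨a, ha⟩ := List.exists_mem_of_ne_nil s hs
        exact (hcube a ha).mono (hsub a (hcube a ha).exists_mem)
      have htail : ∀ a ∈ s.tail, μ < a := by
        cases s with
        | nil => simp
        | cons b t =>
          intro a ha
          exact (hle b (by simp)).trans_lt ((List.pairwise_cons.mp hsort).1 a ha)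
      refine ⟨?_, coneHomotopy_homotopy k μ h s L B hs (fun h => lt_irrefl _ (htail μ h))
        fun _ => (hB L hLμ).2⟩
      rw [← prod_single, coneHomotopy_prod]
      refine Submodule.add_mem _ ?_ ?_
      · rw [blockCone_single]
        split_ifs with hc
        · simp
        · rw [prod_single]
          refine single_mem_supported k 1 ⟨⟨by simp, ?_, ?_⟩, by simp⟩
          · refine List.pairwise_cons.mpr ⟨fun a ha => ?_, hsort⟩
            cases s with
            | nil => simp at ha
            | cons b t =>
              rcases List.mem_cons.mp ha with rfl | ha
              · refine lt_of_le_of_ne (hle a (by simp)) ?_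
                rintro rfl
                simp at hc
              · exact htail a ha
          · exact List.forall_mem_cons.mpr ⟨hLμ, hcube⟩
      · rw [blockAug_single]
        split_ifs with hc
        · rw [one_smul]
          refine supported_mono ?_ (prod_mem_supported k
            (single_mem_supported k (1 : k) (Set.mem_singleton [μ])) (hB L hLμ).1)
          rintro _ ⟨_, rfl, L', ⟨h1, h2⟩, rfl⟩
          refine ⟨⟨by simp, by simp, by simpa using h1⟩, ?_⟩
          simp only [List.flatten_cons, List.length_append, List.length_singleton]
          omega
        · simp

/-- Exactness of the complex of cubes with coordinates in `W`. -/
theorem exists_boundary_eq {d : ℕ} {F : Set (List ℕ)} (hF : IsExchange d F) (W : Set ℕ) (i : ℕ)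
    {x : List (List ℕ) →₀ k}
    (hx : x ∈ supported k k {L | IsCubeIn F L ∧ L.flatten.length = i + d ∧
      ∀ b ∈ L.flatten, b ∈ W})
    (h0 : boundaryLin k x = 0) (haug : i = 0 → aug k x = 0) :
    ∃ y ∈ supported k k {L | IsCubeIn F L ∧ L.flatten.length = i + 1 + d ∧
      ∀ b ∈ L.flatten, b ∈ W}, boundaryLin k y = x := by
  rcases (restrict F W).eq_empty_or_nonempty with he | hne
  · refine ⟨0, Submodule.zero_mem _, ?_⟩
    have : {L | IsCubeIn F L ∧ L.flatten.length = i + d ∧ ∀ b ∈ L.flatten, b ∈ W} = ∅ := by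
      rw [Set.eq_empty_iff_forall_notMem]
      rintro L ⟨h1, -, h2⟩
      obtain ⟨l, hl⟩ := (isCubeIn_restrict_iff.mpr ⟨h1, h2⟩).exists_mem
      rw [he] at hl
      exact hl
    rw [this, supported_empty, Submodule.mem_bot] at hx
    rw [hx, map_zero]
  -- Contracting the restricted family keeps the coordinates of `h x` in `W`.
  · obtain ⟨h, B, hB⟩ := exists_homotopy k (hF.restrict W) hne
    have key : h x ∈ supported k k {L | IsCubeIn F L ∧ L.flatten.length = i + 1 + d ∧
        ∀ b ∈ L.flatten, b ∈ W} ∧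
        boundaryLin k (h x) + h (boundaryLin k x) = x - aug k x • single B 1 ∧
        (i ≠ 0 → aug k x = 0) := by
      rw [supported_eq_span_single] at hx
      refine Submodule.span_induction ?_ (by simp) (fun u v _ _ hu hv => ?_)
        (fun c u _ hu => ?_) hx
      · rintro _ ⟨L, ⟨h1, h2, h3⟩, rfl⟩
        have h4 := hB L (isCubeIn_restrict_iff.mpr ⟨h1, h3⟩)
        refine ⟨supported_mono ?_ h4.1, ?_, fun hi => ?_⟩
        · rintro L' ⟨h5, h6⟩
          rw [isCubeIn_restrict_iff] at h5
          exact ⟨h5.1, by omega, h5.2⟩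
        · rw [boundaryLin_single]
          exact h4.2
        -- For `i ≠ 0` the `d` blocks have more than `d` entries in total, so the cube is not a
        -- point.
        · rw [aug_single, if_neg]
          rw [← length_flatten_eq_iff h1.ne_nil, h2, h1.length_eq hF]
          omega
      · refine ⟨?_, ?_, fun hi => ?_⟩
        · rw [map_add]; exact Submodule.add_mem _ hu.1 hv.1
        · simp only [map_add, add_smul]
          rw [add_add_add_comm, hu.2.1, hv.2.1]; abel
        · rw [map_add, hu.2.2 hi, hv.2.2 hi, add_zero]
      · refine ⟨?_, ?_, fun hi => ?_⟩
        · rw [map_smul]; exact Submodule.smul_mem _ c hu.1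
        · simp only [map_smul, smul_assoc]
          rw [← smul_add, hu.2.1, smul_sub]
        · rw [map_smul, hu.2.2 hi, smul_zero]
    have ha : aug k x = 0 := by
      by_cases hi : i = 0
      · exact haug hi
      · exact key.2.2 hi
    refine ⟨h x, key.1, ?_⟩
    have := key.2.1
    rwa [h0, ha, map_zero, add_zero, zero_smul, sub_zero] at this

end CubeComplex

/-! ### Resolutions from chain complexes with monomial labels -/

section MonomialLabels

open MvPolynomial

variable {σ k : Type*} [Field k] {ι κ ρ : Type*} [Fintype ι] [Fintype κ]

/-- The homogeneous map of graded free modules with coefficients `α`, where the basis vectors have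
the monomial degrees `lι` and `lκ`. -/
noncomputable def monomialMap (lι : ι → σ →₀ ℕ) (lκ : κ → σ →₀ ℕ) (α : ι → κ → k) :
    (ι → MvPolynomial σ k) →ₗ[MvPolynomial σ k] (κ → MvPolynomial σ k) :=
  (Matrix.of fun b a => monomial (lι a - lκ b) (α a b)).mulVecLin

omit [Fintype κ] in
theorem monomialMap_apply (lι : ι → σ →₀ ℕ) (lκ : κ → σ →₀ ℕ) (α : ι → κ → k)
    (f : ι → MvPolynomial σ k) (b : κ) :
    monomialMap lι lκ α f b = ∑ a, monomial (lι a - lκ b) (α a b) * f a := rfl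

omit [Fintype κ] in
theorem monomialMap_single [DecidableEq ι] (lι : ι → σ →₀ ℕ) (lκ : κ → σ →₀ ℕ) (α : ι → κ → k)
    (a : ι) (b : κ) :
    monomialMap lι lκ α (Pi.single a 1) b = monomial (lι a - lκ b) (α a b) := by
  rw [monomialMap_apply, Finset.sum_eq_single a]
  · simp
  · intro c _ hc; simp [hc]
  · simp

/-- The vector of monomials of total degree `γ` with coefficients `u`. -/
noncomputable def strandVec (lι : ι → σ →₀ ℕ) (γ : σ →₀ ℕ) (u : ι → k) : ι → MvPolynomial σ k :=
  fun a => monomial (γ - lι a) (u a)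

-- In degree `γ` the map is just the scalar matrix `α`: where coefficients are nonzero the labels
-- are comparable, so no subtraction of exponents truncates.
omit [Fintype κ] in
theorem monomialMap_strandVec {lι : ι → σ →₀ ℕ} {lκ : κ → σ →₀ ℕ} {α : ι → κ → k}
    (hα : ∀ a b, α a b ≠ 0 → lκ b ≤ lι a) {γ : σ →₀ ℕ} {u : ι → k}
    (hu : ∀ a, ¬ lι a ≤ γ → u a = 0) :
    monomialMap lι lκ α (strandVec lι γ u) = strandVec lκ γ fun b => ∑ a, u a * α a b := by
  funext b
  rw [monomialMap_apply, strandVec, map_sum]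
  refine Finset.sum_congr rfl fun a _ => ?_
  rw [strandVec, monomial_mul]
  by_cases h1 : α a b = 0
  · simp [h1]
  by_cases h2 : lι a ≤ γ
  · rw [add_comm, tsub_add_tsub_cancel h2 (hα a b h1), mul_comm]
  · simp [hu a h2]

omit [Fintype κ] in
theorem coeff_monomialMap {lι : ι → σ →₀ ℕ} {lκ : κ → σ →₀ ℕ} {α : ι → κ → k}
    (hα : ∀ a b, α a b ≠ 0 → lκ b ≤ lι a) {γ : σ →₀ ℕ} (f : ι → MvPolynomial σ k) {b : κ}
    (hb : lκ b ≤ γ) [∀ a, Decidable (lι a ≤ γ)] :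
    (monomialMap lι lκ α f b).coeff (γ - lκ b) =
      ∑ a, (if lι a ≤ γ then (f a).coeff (γ - lι a) else 0) * α a b := by
  classical
  rw [monomialMap_apply, coeff_sum]
  refine Finset.sum_congr rfl fun a _ => ?_
  rw [coeff_monomial_mul']
  by_cases h1 : α a b = 0
  · simp [h1]
  have h2 := hα a b h1
  have h3 : lι a - lκ b ≤ γ - lκ b ↔ lι a ≤ γ := by
    rw [tsub_le_iff_right, tsub_add_cancel_of_le hb]
  simp only [h3]
  split_ifs with h4
  · rw [tsub_tsub_tsub_cancel_right h2, mul_comm]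
  · simp

/-- The relevant degrees are `m + lι a` for monomials `m` of `f a`. This reduces kernels over the
polynomial ring to linear algebra over `k`. -/
theorem exists_strandVec_sum (lι : ι → σ →₀ ℕ) (f : ι → MvPolynomial σ k)
    [∀ γ a, Decidable (lι a ≤ γ)] :
    ∃ Γ : Finset (σ →₀ ℕ), f = ∑ γ ∈ Γ,
      strandVec lι γ fun a => if lι a ≤ γ then (f a).coeff (γ - lι a) else 0 := by
  classical
  refine ⟨Finset.univ.biUnion fun a => (f a).support.image (· + lι a), ?_⟩
  funext a
  ext m
  rw [Finset.sum_apply, coeff_sum, Finset.sum_eq_single (m + lι a)]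
  · simp [strandVec]
  · intro γ _ hγ
    rw [strandVec, coeff_monomial]
    split_ifs with h1 h2
    · rw [← h1, tsub_add_cancel_of_le h2] at hγ
      exact absurd rfl hγ
    · rfl
    · rfl
  · intro h
    have : (f a).coeff m = 0 := by
      by_contra h1
      exact h (Finset.mem_biUnion.mpr ⟨a, Finset.mem_univ _,
        Finset.mem_image.mpr ⟨m, mem_support_iff.mpr h1, rfl⟩⟩)
    simp [strandVec, this]

/-- Exactness in every degree of the coefficients gives exactness of graded free modules. -/
theorem range_monomialMap_eq_ker {lι : ι → σ →₀ ℕ} {lκ : κ → σ →₀ ℕ} {lρ : ρ → σ →₀ ℕ}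
    {α : ι → κ → k} {β : κ → ρ → k} (hα : ∀ a b, α a b ≠ 0 → lκ b ≤ lι a)
    (hβ : ∀ a b, β a b ≠ 0 → lρ b ≤ lκ a) (hαβ : ∀ a c, ∑ b, α a b * β b c = 0)
    (hexact : ∀ (γ : σ →₀ ℕ) (u : κ → k), (∀ b, ¬ lκ b ≤ γ → u b = 0) →
      (∀ c, ∑ b, u b * β b c = 0) →
      ∃ w : ι → k, (∀ a, ¬ lι a ≤ γ → w a = 0) ∧ ∀ b, ∑ a, w a * α a b = u b) :
    LinearMap.range (monomialMap lι lκ α) = LinearMap.ker (monomialMap lκ lρ β) := by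
  classical
  apply le_antisymm
  · rw [LinearMap.range_le_ker_iff]
    refine (Pi.basisFun _ ι).ext fun a => ?_
    -- A basis vector is a strand in the degree given by its own label.
    have h1 : (Pi.basisFun (MvPolynomial σ k) ι) a = strandVec lι (lι a) (Pi.single a 1) := by
      funext c
      rw [Pi.basisFun_apply, strandVec]
      by_cases h : c = a
      · subst h; simp
      · simp [h]
    have h2 : ∀ (u : κ → k), u = α a → ∀ b, ¬ lκ b ≤ lι a → u b = 0 := by
      rintro _ rfl b hb
      by_contra h
      exact hb (hα a b h)
    rw [LinearMap.comp_apply, h1, monomialMap_strandVec hα, monomialMap_strandVec hβ (h2 _ ?_)]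
    · funext c
      simp [strandVec, Pi.single_apply, hαβ]
    · funext b
      simp [Pi.single_apply]
    · intro c hc
      rw [Pi.single_apply, if_neg]
      rintro rfl
      exact hc le_rfl
  · intro f hf
    obtain ⟨Γ, hΓ⟩ := exists_strandVec_sum lκ f
    rw [hΓ]
    refine Submodule.sum_mem _ fun γ _ => ?_
    obtain ⟨w, hw, hwu⟩ := hexact γ
      (fun b => if lκ b ≤ γ then (f b).coeff (γ - lκ b) else 0)
      (fun b hb => if_neg hb) (fun c => by
        by_cases hc : lρ c ≤ γ
        · rw [← coeff_monomialMap hβ f hc, LinearMap.mem_ker.mp hf]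
          simp
        · refine Finset.sum_eq_zero fun b _ => ?_
          by_cases h1 : β b c = 0
          · rw [h1, mul_zero]
          · rw [if_neg fun h2 => hc ((hβ b c h1).trans h2), zero_mul])
    refine ⟨strandVec lι γ w, ?_⟩
    rw [monomialMap_strandVec hα hw]
    congr 1
    funext b
    exact hwu b

/-- The minimal graded free resolution given by a chain complex of vector spaces whose basis
vectors carry monomial labels, exact in every degree. -/
noncomputable def MinimalGradedFreeResolution.ofLabels (r : ℕ → ℕ)
    (lab : ∀ i, Fin (r i) → σ →₀ ℕ) (α : ∀ i, Fin (r (i + 1)) → Fin (r i) → k)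
    (hα : ∀ i a b, α i a b ≠ 0 → lab i b < lab (i + 1) a)
    (hsq : ∀ i a c, ∑ b, α (i + 1) a b * α i b c = 0) (haug : ∀ a, ∑ b, α 0 a b = 0)
    (hexact_zero : ∀ (γ : σ →₀ ℕ) (u : Fin (r 0) → k), (∀ b, ¬ lab 0 b ≤ γ → u b = 0) →
      ∑ b, u b = 0 → ∃ w : Fin (r 1) → k, (∀ a, ¬ lab 1 a ≤ γ → w a = 0) ∧
        ∀ b, ∑ a, w a * α 0 a b = u b)
    (hexact_succ : ∀ i (γ : σ →₀ ℕ) (u : Fin (r (i + 1)) → k),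
      (∀ b, ¬ lab (i + 1) b ≤ γ → u b = 0) → (∀ c, ∑ b, u b * α i b c = 0) →
      ∃ w : Fin (r (i + 2)) → k, (∀ a, ¬ lab (i + 2) a ≤ γ → w a = 0) ∧
        ∀ b, ∑ a, w a * α (i + 1) a b = u b) :
    MinimalGradedFreeResolution (Ideal.span (Set.range fun a => monomial (lab 0 a) (1 : k))) where
  rank := r
  deg i a v := lab i a v
  d i := monomialMap (lab (i + 1)) (lab i) (α i)
  ε := LinearMap.proj (0 : Fin 1) ∘ₗ monomialMap (lab 0) (fun _ : Fin 1 => 0) fun _ _ => 1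
  ε_homogeneous a m hm v := by
    rw [LinearMap.comp_apply, LinearMap.proj_apply, monomialMap_single] at hm
    rw [Finset.mem_singleton.mp (support_monomial_subset hm), tsub_zero]
  d_homogeneous i a b m hm v := by
    rw [monomialMap_single] at hm
    have h0 : α i a b ≠ 0 := by
      rintro h
      simp [h] at hm
    rw [Finset.mem_singleton.mp (support_monomial_subset hm), Finsupp.tsub_apply,
      Nat.cast_sub ((hα i a b h0).le v)]
    ring
  range_ε := by
    ext f
    rw [Ideal.mem_span_range_iff_exists_fun, LinearMap.mem_range]
    refine exists_congr fun c => ?_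
    rw [LinearMap.comp_apply, LinearMap.proj_apply, monomialMap_apply]
    simp [mul_comm]
  exact_zero := by
    -- The augmentation is viewed as a map to vectors of length one with label `0`, so the general
    -- exactness criterion applies to it.
    have h : ∀ N : (Fin (r 0) → MvPolynomial σ k) →ₗ[MvPolynomial σ k]
        (Fin 1 → MvPolynomial σ k),
        LinearMap.ker (LinearMap.proj (0 : Fin 1) ∘ₗ N) = LinearMap.ker N := by
      intro N
      ext x
      rw [LinearMap.mem_ker, LinearMap.mem_ker, LinearMap.comp_apply, LinearMap.proj_apply]
      refine ⟨fun h => funext fun j => ?_, fun h => congrFun h 0⟩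
      rw [Fin.eq_zero j, h, Pi.zero_apply]
    rw [h]
    refine range_monomialMap_eq_ker (fun a b h => (hα 0 a b h).le) (fun _ _ _ => zero_le)
      (fun a c => by simpa using haug a) fun γ u hu hβ => hexact_zero γ u hu
        (by simpa using hβ 0)
  exact_succ i := range_monomialMap_eq_ker (fun a b h => (hα _ a b h).le)
    (fun a b h => (hα _ a b h).le) (hsq i) (hexact_succ i)
  minimal i a b := by
    classical
    rw [monomialMap_single, constantCoeff_monomial]
    split_ifs with h
    · by_contra h0
      exact (hα i a b h0).not_ge (tsub_eq_zero_iff_le.mp h)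
    · rfl

end MonomialLabels

/-! ### Cointerval graphs: exchange property, cells and labels -/

namespace DGraph

open CubeComplex

/-- The edges of `H` as sorted lists. -/
def tuples {d : ℕ} (H : DGraph ℕ d) : Set (List ℕ) :=
  {l | l.Pairwise (· < ·) ∧ l.toFinset ∈ H.edges}

theorem tupleLayer_tuples {d : ℕ} (H : DGraph ℕ (d + 1)) (a : ℕ) :
    tupleLayer H.tuples a = (H.layer a).tuples := by
  ext l
  simp only [tupleLayer, tuples, layer, Set.mem_ofPred_eq, List.pairwise_cons, List.toFinset_cons,
    Finset.mem_filter, Finset.mem_powerset]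
  constructor
  · rintro ⟨⟨h1, h2⟩, h3⟩
    refine ⟨h2, fun b hb => ?_, h3⟩
    rw [Finset.mem_filter]
    exact ⟨H.edges_subset _ h3 (Finset.mem_insert_of_mem hb), h1 b (List.mem_toFinset.mp hb)⟩
  · rintro ⟨h1, h2, h3⟩
    exact ⟨⟨fun b hb => (Finset.mem_filter.mp (h2 (List.mem_toFinset.mpr hb))).2, h1⟩, h3⟩

theorem mem_verts_of_mem_tuples {d : ℕ} {H : DGraph ℕ d} {l : List ℕ} (hl : l ∈ H.tuples) {a : ℕ}
    (ha : a ∈ l) : a ∈ H.verts :=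
  H.edges_subset _ hl.2 (List.mem_toFinset.mpr ha)

theorem length_of_mem_tuples {d : ℕ} {H : DGraph ℕ d} {l : List ℕ} (hl : l ∈ H.tuples) :
    l.length = d := by
  rw [← H.card_edges _ hl.2, List.toFinset_card_of_nodup (hl.1.imp ne_of_lt)]

/-- Between vertices, exchange is the cointerval inclusion of layers; labels that are not vertices
have empty layers, which the nonemptiness clause excludes. -/
theorem IsCointerval.isExchange {d : ℕ} {H : DGraph ℕ d} (hH : H.IsCointerval) :
    IsExchange d H.tuples := by
  induction d with
  | zero => exact fun l hl => List.length_eq_zero_iff.mp (length_of_mem_tuples hl)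
  | succ d ih =>
    have hlayer : ∀ a ∈ H.verts, (H.layer a).IsCointerval := by
      intro a ha
      cases d with
      | zero => trivial
      | succ d => exact hH.1 a ha
    have hempty : ∀ {a l}, l ∈ tupleLayer H.tuples a → a ∈ H.verts := fun hl =>
      mem_verts_of_mem_tuples hl (by simp)
    refine ⟨fun h => by simpa using length_of_mem_tuples h, fun a => ?_, ?_⟩
    · by_cases ha : a ∈ H.verts
      · rw [tupleLayer_tuples]; exact ih (hlayer a ha)
      · rw [show tupleLayer H.tuples a = ∅ from
          Set.eq_empty_iff_forall_notMem.mpr fun l hl => ha (hempty hl)]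
        exact isExchange_empty d
    · rintro a b hab ⟨l, hl⟩ l' hl'
      have ha := hempty hl
      have hb := hempty hl'
      cases d with
      -- Cointervality says nothing about `1`-graphs. Here a layer can contain only the empty tuple,
      -- so nonemptiness of the layer of `a` gives the inclusion.
      | zero =>
        have h1 := length_of_mem_tuples hl
        have h2 := length_of_mem_tuples hl'
        simp only [List.length_cons, zero_add, Nat.add_eq_right, List.length_eq_zero_iff] at h1 h2
        rwa [h2, ← h1]
      | succ d =>
        rw [tupleLayer_tuples]
        rw [tupleLayer_tuples] at hl'
        exact ⟨hl'.1, hH.2 a ha b hb hab hl'.2⟩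

variable {d : ℕ} (H : DGraph ℕ d)

/-- The cubes of dimension `i` of the hyper Ferrers diagram. -/
def cells (i : ℕ) : Set (List (List ℕ)) :=
  {L | IsCubeIn H.tuples L ∧ L.flatten.length = i + d}

variable {H}

theorem nodup_flatten {L : List (List ℕ)} (hL : IsCubeIn H.tuples L) : L.flatten.Nodup :=
  (hL.flatten_pairwise fun _ hl => hl.1).imp ne_of_lt

theorem mem_verts_of_mem_flatten {L : List (List ℕ)} (hL : IsCubeIn H.tuples L) {a : ℕ}
    (ha : a ∈ L.flatten) : a ∈ H.verts := by
  obtain ⟨l, hl, hal⟩ := hL.exists_mem_of_mem_flatten ha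
  exact mem_verts_of_mem_tuples hl hal

theorem length_of_isCubeIn {L : List (List ℕ)} (hL : IsCubeIn H.tuples L) : L.length = d := by
  induction L generalizing d with
  | nil => simpa using length_of_mem_tuples (H := H) hL
  | cons s L ih =>
    obtain ⟨a, ha⟩ := List.exists_mem_of_ne_nil s hL.1
    cases d with
    | zero =>
      obtain ⟨l, hl⟩ := hL.exists_mem
      have := length_of_mem_tuples hl
      rw [List.length_eq_zero_iff.mp this] at hl
      obtain ⟨l', hl'⟩ := (hL.2.2 a ha).exists_mem
      exact absurd (length_of_mem_tuples (H := H) hl') (by simp)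
    | succ d =>
      have := hL.2.2 a ha
      rw [tupleLayer_tuples] at this
      simp [ih this]

variable (H)

theorem finite_cells (i : ℕ) : (H.cells i).Finite := by
  have hT : {s : List ℕ | s.Pairwise (· < ·) ∧ ∀ a ∈ s, a ∈ H.verts}.Finite := by
    refine (H.verts.powerset.finite_toSet.image fun e => e.sort (· ≤ ·)).subset ?_
    rintro s ⟨h1, h2⟩
    refine ⟨s.toFinset, ?_, ?_⟩
    · exact Finset.mem_coe.mpr (Finset.mem_powerset.mpr fun a ha => h2 a (List.mem_toFinset.mp ha))
    · exact (List.toFinset_sort (· ≤ ·) (h1.imp ne_of_lt)).mpr (h1.imp le_of_lt)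
  refine ((Set.Finite.pi' fun _ : Fin d => hT).image List.ofFn).subset ?_
  rintro L ⟨hL, -⟩
  obtain rfl := length_of_isCubeIn hL
  refine ⟨L.get, fun j => ⟨?_, fun a ha => mem_verts_of_mem_flatten hL
    (List.mem_flatten.mpr ⟨_, L.get_mem j, ha⟩)⟩, List.ofFn_get L⟩
  exact (hL.flatten_pairwise fun _ hl => hl.1).sublist
    (List.sublist_flatten_of_mem (L.get_mem j))

/-- An enumeration of the cubes of dimension `i`. -/
noncomputable def cellEquiv (i : ℕ) : Fin (Nat.card (H.cells i)) ≃ H.cells i :=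
  haveI := (H.finite_cells i).to_subtype
  (Finite.equivFin _).symm

/-- The exponent vector of the product of the coordinates of a cube. -/
noncomputable def label (L : List (List ℕ)) : H.verts →₀ ℕ :=
  Finsupp.equivFunOnFinite.symm fun v => L.flatten.count (v : ℕ)

theorem label_apply (L : List (List ℕ)) (v : H.verts) : H.label L v = L.flatten.count (v : ℕ) :=
  rfl

variable {H}

/-- Labels are squarefree, so only the support of `γ` matters; this is the set `W` to which
`exists_boundary_eq` is applied. -/
theorem label_le_iff {L : List (List ℕ)} (hL : IsCubeIn H.tuples L) (γ : H.verts →₀ ℕ) :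
    H.label L ≤ γ ↔ ∀ b ∈ L.flatten, b ∈ {v | ∃ h : v ∈ H.verts, γ ⟨v, h⟩ ≠ 0} := by
  constructor
  · intro h b hb
    have hv := mem_verts_of_mem_flatten hL hb
    refine ⟨hv, ?_⟩
    have h1 := h ⟨b, hv⟩
    rw [label_apply] at h1
    have := List.count_pos_iff.mpr hb
    simp only at h1
    omega
  · intro h v
    rw [label_apply]
    by_cases hv : (v : ℕ) ∈ L.flatten
    · obtain ⟨_, h1⟩ := h _ hv
      rw [List.count_eq_one_of_mem (nodup_flatten hL) hv]
      exact Nat.one_le_iff_ne_zero.mpr h1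
    · rw [List.count_eq_zero_of_not_mem hv]
      exact Nat.zero_le _

/-- A facet loses a coordinate; this strictness is the minimality of the resolution. -/
theorem label_lt {L L' : List (List ℕ)} (hL : IsCubeIn H.tuples L)
    (hlen : L'.flatten.length + 1 = L.flatten.length) (hsub : L'.flatten.Sublist L.flatten) :
    H.label L' < H.label L := by
  have hle : H.label L' ≤ H.label L := fun v => hsub.count_le (v : ℕ)
  refine lt_of_le_of_ne hle fun h => ?_
  have : L'.flatten.Perm L.flatten := by
    rw [List.perm_iff_count]
    intro a
    by_cases ha : a ∈ L.flatten
    · exact DFunLike.congr_fun h ⟨a, mem_verts_of_mem_flatten hL ha⟩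
    · rw [List.count_eq_zero_of_not_mem ha,
        List.count_eq_zero_of_not_mem fun h => ha (hsub.subset h)]
  have := this.length_eq
  omega

theorem label_eq_indicator_iff {L : List (List ℕ)} (hL : IsCubeIn H.tuples L) {V : Finset ℕ}
    (hV : V ⊆ H.verts) :
    (fun v => (H.label L v : ℤ)) = H.indicator V ↔ L.flatten.toFinset = V := by
  have hc : ∀ v : H.verts, (H.label L v : ℤ) = if (v : ℕ) ∈ L.flatten then 1 else 0 := by
    intro v
    rw [label_apply]
    split_ifs with hv
    · rw [List.count_eq_one_of_mem (nodup_flatten hL) hv, Nat.cast_one]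
    · rw [List.count_eq_zero_of_not_mem hv, Nat.cast_zero]
  constructor
  · intro h
    have h1 : ∀ v ∈ H.verts, v ∈ L.flatten ↔ v ∈ V := by
      intro v hv
      have := congrFun h ⟨v, hv⟩
      rw [hc, indicator] at this
      simp only at this
      split_ifs at this <;> simp_all
    ext a
    rw [List.mem_toFinset]
    exact ⟨fun ha => (h1 a (mem_verts_of_mem_flatten hL ha)).mp ha,
      fun ha => (h1 a (hV ha)).mpr ha⟩
  · rintro rfl
    funext v
    rw [hc, indicator]
    simp

theorem monomial_label (k : Type*) [Field k] {L : List (List ℕ)} (hL : IsCubeIn H.tuples L) :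
    MvPolynomial.monomial (H.label L) (1 : k) =
      ∏ v ∈ Finset.univ.filter (fun v : H.verts => (v : ℕ) ∈ L.flatten.toFinset),
        MvPolynomial.X v := by
  rw [MvPolynomial.monomial_eq, map_one, one_mul, Finsupp.prod_fintype _ _ (by simp),
    Finset.prod_filter]
  refine Finset.prod_congr rfl fun v _ => ?_
  rw [label_apply]
  simp only [List.mem_toFinset]
  split_ifs with hv
  · rw [List.count_eq_one_of_mem (nodup_flatten hL) hv, pow_one]
  · rw [List.count_eq_zero_of_not_mem hv, pow_zero]

theorem isCubeIn_map_singleton {F : Set (List ℕ)} {l : List ℕ} :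
    IsCubeIn F (l.map fun a => [a]) ↔ l ∈ F := by
  induction l generalizing F with
  | nil => rfl
  | cons a l ih => simp [IsCubeIn, ih, tupleLayer]

theorem eq_map_singleton_flatten {L : List (List ℕ)} (hL : ∀ s ∈ L, s.length = 1) :
    L = L.flatten.map fun a => [a] := by
  induction L with
  | nil => rfl
  | cons s L ih =>
    rw [List.forall_mem_cons] at hL
    obtain ⟨a, rfl⟩ := List.length_eq_one_iff.mp hL.1
    conv_lhs => rw [ih hL.2]
    simp

theorem length_eq_one_of_mem_cells {L : List (List ℕ)} (hL : L ∈ H.cells 0) :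
    ∀ s ∈ L, s.length = 1 := by
  rw [← length_flatten_eq_iff hL.1.ne_nil, hL.2, length_of_isCubeIn hL.1, zero_add]

/-- Cells of dimension zero have singleton blocks, hence are the edges written as sorted lists. -/
theorem span_label_eq_edgeIdeal (k : Type*) [Field k] :
    Ideal.span (Set.range fun a =>
      MvPolynomial.monomial (H.label (H.cellEquiv 0 a)) (1 : k)) = H.edgeIdeal k := by
  rw [edgeIdeal]
  congr 1
  ext f
  constructor
  · rintro ⟨a, rfl⟩
    have hL := (H.cellEquiv 0 a).2
    have h1 := eq_map_singleton_flatten (length_eq_one_of_mem_cells hL)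
    have h2 := hL.1
    rw [h1, isCubeIn_map_singleton] at h2
    exact ⟨_, h2.2, monomial_label k hL.1⟩
  · rintro ⟨e, he, rfl⟩
    have hl : e.sort (· ≤ ·) ∈ H.tuples := ⟨e.sortedLT_sort.pairwise, by simpa using he⟩
    have hL : (e.sort (· ≤ ·)).map (fun a => [a]) ∈ H.cells 0 := by
      refine ⟨isCubeIn_map_singleton.mpr hl, ?_⟩
      simpa [List.length_flatten, Function.comp_def] using H.card_edges e he
    refine ⟨(H.cellEquiv 0).symm ⟨_, hL⟩, ?_⟩
    simp only [Equiv.apply_symm_apply]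
    rw [monomial_label k hL.1]
    congr 1
    ext v
    simp

/-! ### The resolution supported on the complex of cubes -/

/-- A linear map is determined by its values on an enumerated basis. -/
theorem map_eq_sum_of_mem_supported {k Λ M : Type*} [Field k] [AddCommGroup M] [Module k M]
    {A : Set Λ} {r : ℕ} (e : Fin r ≃ A) (φ : (Λ →₀ k) →ₗ[k] M) {x : Λ →₀ k}
    (hx : x ∈ Finsupp.supported k k A) :
    φ x = ∑ b, x (e b) • φ (Finsupp.single (e b : Λ) 1) := by
  classical
  rw [Finsupp.supported_eq_span_single] at hx
  refine Submodule.span_induction ?_ (by simp) (fun u v _ _ hu hv => ?_) (fun c u _ hu => ?_) hx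
  · rintro _ ⟨L, hL, rfl⟩
    rw [Finset.sum_eq_single (e.symm ⟨L, hL⟩)]
    · simp
    · intro b _ hb
      rw [Finsupp.single_apply, if_neg, zero_smul]
      rintro rfl
      exact hb (by simp)
    · simp
  · simp only [map_add, hu, hv, Finsupp.add_apply, add_smul, Finset.sum_add_distrib]
  · simp only [map_smul, hu, Finsupp.smul_apply, smul_assoc, Finset.smul_sum]

theorem boundary_mem_cells (k : Type*) [Field k] {i : ℕ} {L : List (List ℕ)}
    (hL : L ∈ H.cells (i + 1)) : boundary k L ∈ Finsupp.supported k k (H.cells i) := by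
  refine Finsupp.supported_mono ?_ (boundary_mem k hL.1)
  rintro L' ⟨h1, h2, -⟩
  refine ⟨h1, ?_⟩
  have := hL.2
  omega

/-- A facet would have only `d - 1` coordinates, too few for `d` nonempty blocks. -/
theorem boundary_eq_zero (k : Type*) [Field k] {L : List (List ℕ)} (hL : L ∈ H.cells 0) :
    boundary k L = 0 := by
  have h := boundary_mem k hL.1
  rw [show {L' | IsCubeIn H.tuples L' ∧ L'.flatten.length + 1 = L.flatten.length ∧
    L'.flatten.Sublist L.flatten} = ∅ from ?_] at h
  · simpa using h
  · rw [Set.eq_empty_iff_forall_notMem]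
    rintro L' ⟨h1, h2, -⟩
    have h3 := length_le_length_flatten h1.ne_nil
    rw [length_of_isCubeIn h1] at h3
    have := hL.2
    omega

/-- Exactness of the complex of cubes in a fixed degree. -/
theorem exists_strand_preimage (k : Type*) [Field k] (hH : H.IsCointerval) (i : ℕ)
    (γ : H.verts →₀ ℕ) (u : Fin (Nat.card (H.cells i)) → k)
    (hu : ∀ b, ¬ H.label (H.cellEquiv i b) ≤ γ → u b = 0)
    (h0 : boundaryLin k (∑ b, u b • Finsupp.single (H.cellEquiv i b).1 1) = 0)
    (haug : i = 0 → ∑ b, u b = 0) :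
    ∃ w : Fin (Nat.card (H.cells (i + 1))) → k,
      (∀ a, ¬ H.label (H.cellEquiv (i + 1) a) ≤ γ → w a = 0) ∧
      ∀ b, ∑ a, w a * boundary k (H.cellEquiv (i + 1) a).1 (H.cellEquiv i b).1 = u b := by
  classical
  obtain ⟨y, hy, hyx⟩ := exists_boundary_eq k hH.isExchange
    {v | ∃ h : v ∈ H.verts, γ ⟨v, h⟩ ≠ 0} i
    (x := ∑ b, u b • Finsupp.single (H.cellEquiv i b).1 1) (by
      refine Submodule.sum_mem _ fun b _ => ?_
      by_cases hb : H.label (H.cellEquiv i b) ≤ γ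
      · exact Submodule.smul_mem _ _ (Finsupp.single_mem_supported k 1
          ⟨(H.cellEquiv i b).2.1, (H.cellEquiv i b).2.2,
            (label_le_iff (H.cellEquiv i b).2.1 γ).mp hb⟩)
      · rw [hu b hb, zero_smul]; exact Submodule.zero_mem _) h0 (by
      rintro rfl
      rw [map_sum, ← haug rfl]
      refine Finset.sum_congr rfl fun b _ => ?_
      rw [map_smul, aug_single, if_pos (length_eq_one_of_mem_cells (H.cellEquiv 0 b).2),
        smul_eq_mul, mul_one])
  refine ⟨fun a => y (H.cellEquiv (i + 1) a).1, fun a ha => ?_, fun b => ?_⟩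
  · by_contra h
    have := (Finsupp.mem_supported k y).mp hy (Finsupp.mem_support_iff.mpr h)
    exact ha ((label_le_iff (H.cellEquiv (i + 1) a).2.1 γ).mpr this.2.2)
  · have h1 := map_eq_sum_of_mem_supported (H.cellEquiv (i + 1))
      (Finsupp.lapply (H.cellEquiv i b).1 ∘ₗ boundaryLin k)
      ((Finsupp.supported_mono (t := H.cells (i + 1)) fun L hL => ⟨hL.1, hL.2.1⟩) hy)
    rw [LinearMap.comp_apply, hyx] at h1
    simp only [LinearMap.comp_apply, boundaryLin_single, Finsupp.lapply_apply, smul_eq_mul] at h1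
    rw [← h1, Finsupp.finsetSum_apply, Finset.sum_eq_single b]
    · simp
    · intro c _ hc
      rw [Finsupp.smul_apply, Finsupp.single_apply, if_neg, smul_zero]
      exact fun h => hc ((H.cellEquiv i).injective (Subtype.ext h))
    · exact fun h => absurd (Finset.mem_univ b) h

/-- The minimal free resolution of a cointerval ideal supported on the complex of cubes. -/
noncomputable def cubeResolution (k : Type*) [Field k] (hH : H.IsCointerval) :
    MinimalGradedFreeResolution (Ideal.span (Set.range fun a =>
      MvPolynomial.monomial (H.label (H.cellEquiv 0 a)) (1 : k))) :=
  MinimalGradedFreeResolution.ofLabels (fun i => Nat.card (H.cells i))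
    (fun i a => H.label (H.cellEquiv i a))
    (fun i a b => boundary k (H.cellEquiv (i + 1) a).1 (H.cellEquiv i b).1)
    (fun i a b h => by
      have := (Finsupp.mem_supported k _).mp (boundary_mem k (H.cellEquiv (i + 1) a).2.1)
        (Finsupp.mem_support_iff.mpr h)
      exact label_lt (H.cellEquiv (i + 1) a).2.1 this.2.1 this.2.2)
    (fun i a c => by
      have := map_eq_sum_of_mem_supported (H.cellEquiv (i + 1))
        (Finsupp.lapply (H.cellEquiv i c).1 ∘ₗ boundaryLin k)
        (boundary_mem_cells k (H.cellEquiv (i + 1 + 1) a).2)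
      rw [LinearMap.comp_apply, boundaryLin_boundary, map_zero] at this
      simpa using this.symm)
    (fun a => by
      have := map_eq_sum_of_mem_supported (H.cellEquiv 0) (aug k)
        (boundary_mem_cells k (H.cellEquiv (0 + 1) a).2)
      rw [aug_boundary] at this
      rw [this]
      refine Finset.sum_congr rfl fun b _ => ?_
      rw [aug_single, if_pos (length_eq_one_of_mem_cells (H.cellEquiv 0 b).2), smul_eq_mul,
        mul_one])
    (fun γ u hu haug => exists_strand_preimage k hH 0 γ u hu (by
      rw [map_sum]
      refine Finset.sum_eq_zero fun b _ => ?_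
      rw [map_smul, boundaryLin_single, boundary_eq_zero k (H.cellEquiv 0 b).2, smul_zero])
      fun _ => haug)
    (fun i γ u hu h0 => exists_strand_preimage k hH (i + 1) γ u hu (by
      have hmem : boundaryLin k (∑ b, u b • Finsupp.single (H.cellEquiv (i + 1) b).1 1) ∈
          Finsupp.supported k k (H.cells i) := by
        rw [map_sum]
        refine Submodule.sum_mem _ fun b _ => ?_
        rw [map_smul, boundaryLin_single]
        exact Submodule.smul_mem _ _ (boundary_mem_cells k (H.cellEquiv (i + 1) b).2)
      -- Coefficients at cells of dimension `i` vanish by `h0`, all others by the support of the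
      -- boundary.
      ext L
      by_cases hL : L ∈ H.cells i
      · have := h0 ((H.cellEquiv i).symm ⟨L, hL⟩)
        rw [map_sum, Finsupp.finsetSum_apply]
        simpa only [map_smul, boundaryLin_single, Finsupp.smul_apply, smul_eq_mul,
          Equiv.apply_symm_apply, Finsupp.zero_apply] using this
      · exact Finsupp.notMem_support_iff.mp fun h => hL ((Finsupp.mem_supported k _).mp hmem h))
      (by simp))

theorem exists_resolution (k : Type*) [Field k] (hH : H.IsCointerval) :
    ∃ F : MinimalGradedFreeResolution (H.edgeIdeal k), ∀ (i : ℕ) (V : Finset ℕ), V ⊆ H.verts →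
      F.betti i (H.indicator V) = {L | L ∈ H.cells i ∧ L.flatten.toFinset = V}.ncard := by
  rw [← span_label_eq_edgeIdeal]
  refine ⟨cubeResolution k hH, fun i V hV => ?_⟩
  rw [MinimalGradedFreeResolution.betti]
  change {a : Fin (Nat.card (H.cells i)) |
    (fun v => (H.label (H.cellEquiv i a) v : ℤ)) = H.indicator V}.ncard = _
  rw [← Set.ncard_image_of_injective _
    (Subtype.val_injective.comp (H.cellEquiv i).injective)]
  congr 1
  ext L
  constructor
  · rintro ⟨a, ha, rfl⟩
    exact ⟨(H.cellEquiv i a).2, (label_eq_indicator_iff (H.cellEquiv i a).2.1 hV).mp ha⟩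
  · rintro ⟨hL, hLV⟩
    refine ⟨(H.cellEquiv i).symm ⟨L, hL⟩, ?_, congrArg Subtype.val (Equiv.apply_symm_apply _ _)⟩
    rw [Set.mem_ofPred_eq, Equiv.apply_symm_apply]
    exact (label_eq_indicator_iff hL.1 hV).mpr hLV

/-! ### Lists of blocks and cubes -/

theorem isCubeIn_ofFn_iff {d : ℕ} {F : Set (List ℕ)} {g : Fin d → List ℕ} :
    IsCubeIn F (List.ofFn g) ↔ (∀ j, g j ≠ [] ∧ (g j).Pairwise (· < ·)) ∧
      ∀ v : Fin d → ℕ, (∀ j, v j ∈ g j) → List.ofFn v ∈ F := by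
  induction d generalizing F with
  | zero => simp [IsCubeIn]
  | succ d ih =>
    rw [List.ofFn_succ, IsCubeIn]
    simp only [ih, Fin.forall_fin_succ (P := fun j => g j ≠ [] ∧ (g j).Pairwise (· < ·))]
    constructor
    · rintro ⟨h1, h2, h3⟩
      obtain ⟨a, ha⟩ := List.exists_mem_of_ne_nil _ h1
      refine ⟨⟨⟨h1, h2⟩, (h3 a ha).1⟩, fun v hv => ?_⟩
      rw [List.ofFn_succ]
      exact (h3 _ (hv 0)).2 _ fun j => hv j.succ
    · rintro ⟨⟨⟨h1, h2⟩, h3⟩, h4⟩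
      refine ⟨h1, h2, fun a ha => ⟨h3, fun v hv => ?_⟩⟩
      have := h4 (Fin.cons a v) (Fin.forall_fin_succ.mpr ⟨by simpa using ha, by simpa using hv⟩)
      simpa [List.ofFn_succ, tupleLayer] using this

theorem ofFn_mem_tuples_iff {v : Fin d → ℕ} : List.ofFn v ∈ H.tuples ↔ v ∈ H.hyperFerrers := by
  have : (List.ofFn v).toFinset = Finset.univ.image v := by
    ext a; simp
  rw [tuples, hyperFerrers, Set.mem_ofPred_eq, Set.mem_ofPred_eq, this, List.pairwise_ofFn]
  exact Iff.rfl

/-- Both sides are parametrised by `d`-tuples of sorted nonempty blocks. Sides of a cube are finite,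
being contained in `V`; a nonempty product determines its sides as its projections, and a sorted
list is determined by its set of entries. -/
theorem ncard_cubes (V : Finset ℕ) :
    {C : Set (Fin d → ℕ) | C ⊆ H.hyperFerrers ∧ IsCubeWithCoordinates C V}.ncard =
      {L | IsCubeIn H.tuples L ∧ L.flatten.toFinset = V}.ncard := by
  have h1 : {L | IsCubeIn H.tuples L ∧ L.flatten.toFinset = V} = List.ofFn ''
      {g : Fin d → List ℕ | IsCubeIn H.tuples (List.ofFn g) ∧
        (List.ofFn g).flatten.toFinset = V} := by
    ext L
    constructor
    · rintro ⟨hL, hLV⟩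
      have := length_of_isCubeIn hL
      subst this
      exact ⟨L.get, by simpa [List.ofFn_get] using ⟨hL, hLV⟩, List.ofFn_get L⟩
    · rintro ⟨g, hg, rfl⟩
      exact hg
  have h2 : {C : Set (Fin d → ℕ) | C ⊆ H.hyperFerrers ∧ IsCubeWithCoordinates C V} =
      (fun g : Fin d → List ℕ => Set.univ.pi fun j => {x | x ∈ g j}) ''
      {g : Fin d → List ℕ | IsCubeIn H.tuples (List.ofFn g) ∧
        (List.ofFn g).flatten.toFinset = V} := by
    ext C
    constructor
    · rintro ⟨hC, S, hS, rfl, hSV⟩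
      have hfin : ∀ j, (S j).Finite := fun j =>
        V.finite_toSet.subset (hSV ▸ Set.subset_iUnion S j)
      refine ⟨fun j => (hfin j).toFinset.sort (· ≤ ·), ⟨isCubeIn_ofFn_iff.mpr ⟨fun j => ⟨?_, ?_⟩,
        fun v hv => ?_⟩, ?_⟩, ?_⟩
      · obtain ⟨x, hx⟩ := hS j
        exact List.ne_nil_of_mem (a := x) (by simpa using hx)
      · exact ((hfin j).toFinset.sortedLT_sort).pairwise
      · rw [ofFn_mem_tuples_iff]
        exact hC fun j _ => by simpa using hv j
      · rw [← Finset.coe_inj, ← hSV]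
        ext x
        simp [List.mem_ofFn]
      · simp
    · rintro ⟨g, ⟨hg, hgV⟩, rfl⟩
      rw [isCubeIn_ofFn_iff] at hg
      refine ⟨fun v hv => ?_, _, fun j => ?_, rfl, ?_⟩
      · rw [← ofFn_mem_tuples_iff]
        exact hg.2 v fun j => hv j trivial
      · exact List.exists_mem_of_ne_nil _ (hg.1 j).1
      · rw [← hgV]
        ext x
        simp [List.mem_ofFn]
  rw [h1, h2, Set.ncard_image_of_injective _ List.ofFn_injective]
  refine Set.InjOn.ncard_image ?_
  rintro g ⟨hg, -⟩ g' ⟨hg', -⟩ h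
  rw [isCubeIn_ofFn_iff] at hg hg'
  funext j
  have hne : ∀ g : Fin d → List ℕ, (∀ j, g j ≠ []) →
      (Set.univ.pi fun j => {x | x ∈ g j}).Nonempty := fun g h =>
    Set.univ_pi_nonempty_iff.mpr fun j => List.exists_mem_of_ne_nil _ (h j)
  have hj := congrArg (Set.image (fun v : Fin d → ℕ => v j)) h
  have e1 := Set.eval_image_univ_pi (i := j) (hne g fun j => (hg.1 j).1)
  have e2 := Set.eval_image_univ_pi (i := j) (hne g' fun j => (hg'.1 j).1)
  have hmem : ∀ x, x ∈ g j ↔ x ∈ g' j := fun x =>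
    Set.ext_iff.mp (e1.symm.trans (hj.trans e2)) x
  refine List.Perm.eq_of_pairwise' (hg.1 j).2 (hg'.1 j).2 ?_
  exact (List.perm_ext_iff_of_nodup ((hg.1 j).2.imp ne_of_lt) ((hg'.1 j).2.imp ne_of_lt)).mpr hmem

end DGraph

/-- The homological degree `|V| - d` is the `i` with `i + d = |V|`, avoiding truncated subtraction.
The last conjunct covers negative degrees, where the Betti number is zero by convention; the first
keeps the quantification over `F` from being vacuous. -/
theorem mainTheorem8 (k : Type*) [Field k] (n d : ℕ) (hd : 1 ≤ d) (H : DGraph ℕ d)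
    (hverts : H.verts = Finset.Icc 1 n) (hH : H.IsCointerval)
    (V : Finset ℕ) (hV : V ⊆ Finset.Icc 1 n) :
    Nonempty (MinimalGradedFreeResolution (H.edgeIdeal k)) ∧
    (∀ (F : MinimalGradedFreeResolution (H.edgeIdeal k)) (i : ℕ), i + d = V.card →
      F.betti i (H.indicator V) =
        {C : Set (Fin d → ℕ) | C ⊆ H.hyperFerrers ∧ IsCubeWithCoordinates C V}.ncard) ∧
    (V.card < d →
      {C : Set (Fin d → ℕ) | C ⊆ H.hyperFerrers ∧ IsCubeWithCoordinates C V}.ncard = 0) := by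
  obtain ⟨G, hG⟩ := DGraph.exists_resolution k hH
  -- Coordinates are distinct, so `V` alone fixes the dimension of the cube and the degree in which
  -- it is counted.
  have hcard : ∀ L, CubeComplex.IsCubeIn H.tuples L → L.flatten.toFinset = V →
      L.flatten.length = V.card := fun L hL h => by
    rw [← h, List.toFinset_card_of_nodup (DGraph.nodup_flatten hL)]
  refine ⟨⟨G⟩, fun F i hi => ?_, fun hlt => ?_⟩
  · rw [F.betti_eq G, hG i V (hverts ▸ hV), DGraph.ncard_cubes]
    congr 1
    ext L
    exact ⟨fun h => ⟨h.1.1, h.2⟩, fun h => ⟨⟨h.1, (hcard L h.1 h.2).trans hi.symm⟩, h.2⟩⟩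
  · rw [DGraph.ncard_cubes, show {L | CubeComplex.IsCubeIn H.tuples L ∧
      L.flatten.toFinset = V} = ∅ from ?_, Set.ncard_empty]
    rw [Set.eq_empty_iff_forall_notMem]
    rintro L ⟨hL, hLV⟩
    have h1 := CubeComplex.length_le_length_flatten hL.ne_nil
    rw [DGraph.length_of_isCubeIn hL, hcard L hL hLV] at h1
    omega
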